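/- Let $A$ be a commutative Noetherian ring satisfying Serre's condition $(S_2)$, that is, $\operatorname{depth} A_P \ge \min\{2, \dim A_P\}$ for every $P \in \operatorname{Spec} A$. For a commutative ring $R$, let $\overline{R}$ be the integral closure of $R$ in its total ring of fractions $\mathrm{Q}(R)$. We say that $R$ is strictly closed in $\overline{R}$ if $R = \{x \in \overline{R} \mid x \otimes 1 = 1 \otimes x \text{ in } \overline{R} \otimes_R \overline{R}\}$, and that $R$ is weakly Arf if $yz/x \in R$ whenever $x, y, z \in R$, $x$ is a non-zerodivisor on $R$, and $y/x, z/x \in \overline{R}$. An Arf ring is a weakly Arf, Noetherian semi-local ring $R$ such that $R_M$ is a one-dimensional Cohen-Macaulay local ring for every maximal ideal $M$ of $R$, and such that every integrally closed ideal $I$ of $R$ that contains a non-zerodivisor satisfies $I^{n+1} = aI^n$ for some $n \ge 0$ and some $a \in I$. Then the following conditions are equivalent. (1) $A$ is strictly closed in $\overline{A}$. (2) $A$ is a weakly Arf ring, and $A_P$ is an Arf ring for every $P \in \operatorname{Spec} A$ with $\operatorname{ht}_A P = 1$. -/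

import Mathlib

open scoped TensorProduct nonZeroDivisors

noncomputable section

namespace StrictClosedness

/-- The integral closure of `A` in its total ring of fractions `Q(A)`. -/
abbrev integralClosureInQ (A : Type*) [CommRing A] : Subalgebra A (FractionRing A) :=
  integralClosure A (FractionRing A)

/-- The strict closure of `A` in an `A`-algebra `B`: all `x : B` such that
`x ⊗ 1 = 1 ⊗ x` in `B ⊗[A] B`. -/
def strictClosure (A B : Type*) [CommRing A] [CommRing B] [Algebra A B] : Subalgebra A B :=
  AlgHom.equalizer (Algebra.TensorProduct.includeLeft : B →ₐ[A] B ⊗[A] B)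
    (Algebra.TensorProduct.includeRight : B →ₐ[A] B ⊗[A] B)

theorem mem_strictClosure {A B : Type*} [CommRing A] [CommRing B] [Algebra A B] (x : B) :
    x ∈ strictClosure A B ↔ x ⊗ₜ[A] (1 : B) = (1 : B) ⊗ₜ[A] x :=
  Iff.rfl

/-- `A` is strictly closed in its integral closure: the strict closure of `A` in the integral
closure is (the image of) `A`. -/
def IsStrictlyClosed (A : Type*) [CommRing A] : Prop :=
  strictClosure A (integralClosureInQ A) = ⊥

/-- Weakly Arf rings: if `x` is a non-zerodivisor and `y / x`, `z / x` are integral over `A`,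
then `y z / x` lies in `A`. -/
def IsWeaklyArf (A : Type*) [CommRing A] : Prop :=
  ∀ (x : A⁰) (y z : A),
    IsLocalization.mk' (FractionRing A) y x ∈ integralClosureInQ A →
    IsLocalization.mk' (FractionRing A) z x ∈ integralClosureInQ A →
    IsLocalization.mk' (FractionRing A) (y * z) x ∈ (algebraMap A (FractionRing A)).range

/-- `x` is integral over the ideal `I`: it satisfies an equation
`x ^ n + a₁ x ^ (n - 1) + ⋯ + aₙ = 0` with `n ≥ 1` and `aᵢ ∈ I ^ i`. -/
def IsIntegralOverIdeal {A : Type*} [CommRing A] (I : Ideal A) (x : A) : Prop :=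
  ∃ (n : ℕ) (a : ℕ → A), 1 ≤ n ∧ (∀ i ∈ Finset.Icc 1 n, a i ∈ I ^ i) ∧
    x ^ n + ∑ i ∈ Finset.Icc 1 n, a i * x ^ (n - i) = 0

/-- Integrally closed ideals: every element integral over `I` belongs to `I`. -/
def IsIntegrallyClosedIdeal {A : Type*} [CommRing A] (I : Ideal A) : Prop :=
  ∀ x : A, IsIntegralOverIdeal I x → x ∈ I

/-- `I` has a principal reduction: `I ^ (n + 1) = a I ^ n` for some `n ≥ 0` and `a ∈ I`. -/
def HasPrincipalReduction {A : Type*} [CommRing A] (I : Ideal A) : Prop :=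
  ∃ a ∈ I, ∃ n : ℕ, I ^ (n + 1) = Ideal.span {a} * I ^ n

/-- The depth of a (Noetherian) local ring: the supremum of the lengths of the regular sequences
contained in the maximal ideal. -/
def localDepth (R : Type*) [CommRing R] [IsLocalRing R] : ℕ∞ :=
  ⨆ rs ∈ {rs : List R | (∀ r ∈ rs, r ∈ IsLocalRing.maximalIdeal R) ∧
    RingTheory.Sequence.IsRegular R rs}, (rs.length : ℕ∞)

/-- Cohen-Macaulay local rings: Noetherian with depth equal to the Krull dimension. -/
def IsCohenMacaulayLocal (R : Type*) [CommRing R] [IsLocalRing R] : Prop :=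
  IsNoetherianRing R ∧ (localDepth R : WithBot ℕ∞) = ringKrullDim R

/-- Serre's condition `(Sₙ)`: `depth A_P ≥ min {n, dim A_P}` for every prime `P` of `A`. -/
def SatisfiesSerre (A : Type*) [CommRing A] (n : ℕ) : Prop :=
  ∀ (P : Ideal A) [P.IsPrime],
    min (n : WithBot ℕ∞) (ringKrullDim (Localization.AtPrime P)) ≤
      (localDepth (Localization.AtPrime P) : WithBot ℕ∞)

/-- Arf rings: Noetherian semi-local rings whose localizations at the maximal ideals are all
one-dimensional Cohen-Macaulay local rings, such that every integrally closed ideal containing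
a non-zerodivisor has a principal reduction, and such that `y z / x` lies in `A` whenever `x` is
a non-zerodivisor and `y / x`, `z / x` are integral over `A`. -/
structure IsArf (A : Type*) [CommRing A] : Prop where
  isNoetherianRing : IsNoetherianRing A
  semilocal : Finite (MaximalSpectrum A)
  cohenMacaulay : ∀ (M : Ideal A) [M.IsMaximal],
    IsCohenMacaulayLocal (Localization.AtPrime M) ∧ ringKrullDim (Localization.AtPrime M) = 1
  principalReduction : ∀ I : Ideal A, (∃ a ∈ I, a ∈ A⁰) → IsIntegrallyClosedIdeal I →
    HasPrincipalReduction I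
  weaklyArf : IsWeaklyArf A

end StrictClosedness

end

open scoped TensorProduct nonZeroDivisors

noncomputable section

namespace StrictClosedness

/-! Write `V` for the integral closure. Under `(S₂)` everything reduces to height-one primes. If `x`
lies in the strict closure but not in `A`, some associated prime `P` of `Q(A) / A` contains the
annihilator of the class of `x`. Such a `P` has the form `(b) : c` with `b` regular, so `A_P` has
depth at most one and `P` has height one; if `A_P` is strictly closed, then `x` becomes an element
of `A_P`, which is absurd. Conversely, `(S₂)` excludes embedded primes, so `Q(A)_P = Q(A_P)` and
strict closedness passes to `A_P`.

In dimension one, Arf implies strictly closed by blowing up. For a maximal ideal `m` with `m² = a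
m`, the ring `R₁ = a⁻¹ m` is again Arf (`IsArfIn.blowUp`), and strict closedness of `R₁` gives that
of `R` (`IsStrictlyClosedIn.of_blowUp`). The process stops because the length of `B / R`, for a
finite extension `B` carrying the relation `x ⊗ 1 = 1 ⊗ x`, drops strictly at each step
(`length_map_mkQ_blowUp_lt`).

For the other implication, weak Arf is a direct tensor computation. Principal reductions need one `f
∈ I` with `I ⊆ f V`, and this must be found even over a finite residue field. For `c, y ∈ I` and `τ
= y / c`, a polynomial equation for `τ` with a unit coefficient yields an integral `η` such that `1
+ τ (1 - η)` generates `V + τ V`. Strict closedness puts `y η` in `R`, so `f = c + y - y η` works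
(`IsStrictlyClosed.exists_common_divisor`). -/

/-! ### Elementary properties of strict closures -/

theorem strictClosure_map {C B R B' : Type*} [CommRing C] [CommRing B] [CommRing R] [CommRing B']
    [Algebra C B] [Algebra R B'] [Algebra C R] [Algebra C B'] [IsScalarTower C R B']
    (φ : B →ₐ[C] B') {x : B} (hx : x ∈ strictClosure C B) : φ x ∈ strictClosure R B' := by
  rw [mem_strictClosure] at hx ⊢
  have h := congrArg (fun t => Algebra.TensorProduct.mapOfCompatibleSMul R C C B' B'
    (Algebra.TensorProduct.map φ φ t)) hx
  simpa using h

/-- With `a = y / x` and `b = z / x`, the element `z a = y b` satisfies `z a ⊗ 1 = a ⊗ z = a ⊗ x b =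
x a ⊗ b = y ⊗ b = 1 ⊗ y b`. -/
theorem IsStrictlyClosed.isWeaklyArf {A : Type*} [CommRing A] (h : IsStrictlyClosed A) :
    IsWeaklyArf A := by
  intro x y z hy hz
  set K := FractionRing A
  set a : integralClosureInQ A := ⟨_, hy⟩ with ha
  set b : integralClosureInQ A := ⟨_, hz⟩ with hb
  have hxa : (x : A) • a = algebraMap A _ y := by
    apply Subtype.ext
    simp [ha, Algebra.smul_def, IsLocalization.mk'_spec']
  have hxb : (x : A) • b = algebraMap A _ z := by
    apply Subtype.ext
    simp [hb, Algebra.smul_def, IsLocalization.mk'_spec']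
  have hw : (z • a : integralClosureInQ A) ∈ strictClosure A (integralClosureInQ A) := by
    rw [mem_strictClosure]
    have e : (z • a : integralClosureInQ A) = y • b := by
      rw [Algebra.smul_def, Algebra.smul_def, ← hxa, ← hxb]
      rw [mul_comm, Algebra.mul_smul_comm, Algebra.smul_mul_assoc]
    calc (z • a : integralClosureInQ A) ⊗ₜ[A] (1 : integralClosureInQ A)
        = a ⊗ₜ[A] (algebraMap A _ z) := by
          rw [TensorProduct.smul_tmul, Algebra.algebraMap_eq_smul_one]
      _ = (algebraMap A _ y) ⊗ₜ[A] b := by rw [← hxb, ← TensorProduct.smul_tmul, hxa]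
      _ = 1 ⊗ₜ[A] (z • a) := by
          rw [e, ← TensorProduct.smul_tmul, Algebra.algebraMap_eq_smul_one]
  rw [h, Algebra.mem_bot] at hw
  obtain ⟨r, hr⟩ := hw
  refine ⟨r, ?_⟩
  have := congrArg (fun t : integralClosureInQ A => (t : K)) hr
  simp only [ha, Subalgebra.coe_smul] at this
  rw [mul_comm, ← IsLocalization.smul_mk' , ← this]
  rfl

/-- Moving a numerator across the tensor sign one factor at a time. -/
theorem smul_mem_strictClosure_of_sum_eq_one {R V : Type*} [CommRing R] [CommRing V] [Algebra R V]
    (c y : R) (m : ℕ) (ρ : ℕ → V) (h : ℕ → R)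
    (hρ : ∀ i < m, c • ρ (i + 1) = y • ρ i)
    (hsum : ∑ i ∈ Finset.range (m + 1), h i • ρ i = 1) :
    y • ρ 0 ∈ strictClosure R V := by
  -- The relation `c ρ (i + 1) = y ρ i` makes `ρ j ⊗ y ρ i` depend only on `i + j`: move `y` to the
  -- left, trade it for `c`, and move `c` back.
  have step : ∀ i j, i + j ≤ m → ρ j ⊗ₜ[R] (y • ρ i) = ρ (i + j) ⊗ₜ[R] (y • ρ 0) := by
    intro i
    induction i with
    | zero => intro j _; simp
    | succ i ih =>
      intro j hj
      rw [← TensorProduct.smul_tmul, ← hρ j (by omega), TensorProduct.smul_tmul,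
        hρ i (by omega), ih (j + 1) (by omega)]
      congr 2; omega
  rw [mem_strictClosure]
  calc (y • ρ 0) ⊗ₜ[R] (1 : V)
      = ∑ i ∈ Finset.range (m + 1), h i • (ρ 0 ⊗ₜ[R] (y • ρ i)) := by
        rw [TensorProduct.smul_tmul, ← hsum, Finset.smul_sum, TensorProduct.tmul_sum]
        refine Finset.sum_congr rfl fun i _ => ?_
        rw [smul_comm, TensorProduct.tmul_smul]
    _ = ∑ i ∈ Finset.range (m + 1), (h i • ρ i) ⊗ₜ[R] (y • ρ 0) := by
        refine Finset.sum_congr rfl fun i hi => ?_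
        rw [step i 0 (by simpa [Nat.lt_succ_iff] using hi), add_zero, TensorProduct.smul_tmul']
    _ = 1 ⊗ₜ[R] (y • ρ 0) := by rw [← TensorProduct.sum_tmul, hsum]

/-- Strict closedness of elements descends along localization of the base, up to a denominator. -/
theorem exists_smul_mem_strictClosure {A V R V' : Type*} [CommRing A] [CommRing V] [CommRing R]
    [CommRing V'] [Algebra A V] [Algebra R V'] [Algebra A R] [Algebra A V'] [IsScalarTower A R V']
    (S : Submonoid A) [IsLocalization S R] (φ : V →ₐ[A] V')
    [IsLocalizedModule S φ.toLinearMap] {v : V} (hv : φ v ∈ strictClosure R V') :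
    ∃ s ∈ S, s • v ∈ strictClosure A V := by
  rw [mem_strictClosure] at hv
  have h1 : (φ v) ⊗ₜ[A] (1 : V') = (1 : V') ⊗ₜ[A] (φ v) := 
    congrArg (IsLocalization.moduleTensorEquiv S R V' V') hv
  have h2 : TensorProduct.map φ.toLinearMap φ.toLinearMap (v ⊗ₜ[A] (1 : V)) =
      TensorProduct.map φ.toLinearMap φ.toLinearMap ((1 : V) ⊗ₜ[A] v) := by simpa using h1
  obtain ⟨s, hs⟩ := (IsLocalizedModule.eq_iff_exists S _).1 h2
  refine ⟨s, s.2, ?_⟩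
  rw [mem_strictClosure, ← TensorProduct.smul_tmul', TensorProduct.tmul_smul]
  exact hs

/-! ### Comparing tensor products over a ring and over its blow-up -/

section BlowUpStep

variable {R R₁ B : Type*} [CommRing R] [CommRing R₁] [CommRing B] [Algebra R R₁] [Algebra R₁ B]
  [Algebra R B] [IsScalarTower R R₁ B]

/-- If `C` is the quotient of `B` by a principal ideal and the maximal ideal `m` of `R` kills `C`,
an element of the strict closure is congruent to an element of `R`. -/
theorem exists_sub_mem_of_mem_strictClosure (m : Ideal R) [m.IsMaximal] (J : Ideal B)
    (hJ : J ≠ ⊤) (hm : ∀ r ∈ m, algebraMap R B r ∈ J) {x : B} (hx : x ∈ strictClosure R B) :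
    ∃ r : R, x - algebraMap R B r ∈ J := by
  have htor : Module.IsTorsionBySet R (B ⧸ J) m := by
    rintro c ⟨r, hr⟩
    obtain ⟨b, rfl⟩ := Ideal.Quotient.mk_surjective c
    change Ideal.Quotient.mk J (r • b) = 0
    rw [Ideal.Quotient.eq_zero_iff_mem, Algebra.smul_def]
    exact J.mul_mem_right _ (hm r hr)
  let _ : Module (R ⧸ m) (B ⧸ J) := htor.module
  have : IsScalarTower R (R ⧸ m) (B ⧸ J) := htor.isScalarTower
  let _ : Field (R ⧸ m) := Ideal.Quotient.field m
  have : Nontrivial (B ⧸ J) := Ideal.Quotient.nontrivial_iff.2 hJ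
  -- A linear form `φ` on the `R / m`-vector space `B / J` with `φ 1 = 1` gives the bilinear map
  -- `(b, c) ↦ φ(b) c`. Evaluated on `x ⊗ 1 = 1 ⊗ x` it says that `x` is `φ(x) · 1` in `B / J`.
  obtain ⟨φ, hφ⟩ := LinearMap.exists_leftInverse_of_injective
    (LinearMap.toSpanSingleton (R ⧸ m) (B ⧸ J) 1)
    (LinearMap.ker_toSpanSingleton (R ⧸ m) (one_ne_zero))
  have hφ1 : φ 1 = 1 := by simpa using LinearMap.congr_fun hφ 1
  let q : B →ₗ[R] (B ⧸ J) := (Ideal.Quotient.mkₐ R J).toLinearMap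
  let f : B →ₗ[R] B →ₗ[R] (B ⧸ J) :=
    LinearMap.mk₂ R (fun b c => φ (q b) • q c)
      (fun b b' c => by simp only [map_add, add_smul])
      (fun r b c => by
        have : φ (r • q b) = r • φ (q b) := (φ.restrictScalars R).map_smul r (q b)
        rw [map_smul, this, smul_assoc])
      (fun b c c' => by simp only [map_add, smul_add])
      (fun r b c => by rw [map_smul, smul_comm])
  have h := congrArg (TensorProduct.lift f) ((mem_strictClosure x).1 hx)
  have hq1 : q 1 = 1 := map_one (Ideal.Quotient.mkₐ R J)
  simp only [TensorProduct.lift.tmul] at h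
  change φ (q x) • q 1 = φ (q 1) • q x at h
  rw [hq1, hφ1, one_smul] at h
  obtain ⟨r, hr⟩ := Ideal.Quotient.mk_surjective (φ (q x))
  refine ⟨r, ?_⟩
  rw [← Ideal.Quotient.eq_zero_iff_mem, map_sub, sub_eq_zero]
  change q x = q (algebraMap R B r)
  rw [← h, ← hr, Algebra.algebraMap_eq_smul_one, map_smul, hq1]
  have hmk : Ideal.Quotient.mk m r = r • (1 : R ⧸ m) := by
    rw [← Ideal.Quotient.algebraMap_eq, Algebra.algebraMap_eq_smul_one]
  rw [hmk, smul_assoc, one_smul]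

/-- An element of `B ⊗[R] B` killed by `a` dies in `B ⊗[R₁] B`, where `a R₁` is a maximal ideal
of `R` and `a` is regular on `B`. -/
theorem mapOfCompatibleSMul_eq_zero_of_smul_eq_zero (m : Ideal R) [m.IsMaximal] (a : R)
    (α : R₁ →ₗ[R] R) (hα : ∀ s, algebraMap R B (α s) = a • algebraMap R₁ B s)
    (hrange : ∀ r ∈ m, ∃ s, α s = r)
    (ha : ∀ b : B, a • b = 0 → b = 0) (t : B ⊗[R] B) (ht : a • t = 0) :
    TensorProduct.mapOfCompatibleSMul R₁ R R B B t = 0 := by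
  classical
  set J : Ideal B := Ideal.span {algebraMap R B a} with hJ
  have hαb : ∀ s (b : B), α s • b = a • s • b := fun s b => by
    rw [Algebra.smul_def, hα, Algebra.smul_mul_assoc, Algebra.smul_def s b]
  have htor : Module.IsTorsionBySet R (B ⧸ J) m := by
    rintro c ⟨r, hr⟩
    obtain ⟨s, rfl⟩ := hrange r hr
    obtain ⟨b, rfl⟩ := Ideal.Quotient.mk_surjective c
    change Ideal.Quotient.mk J (α s • b) = 0
    rw [Ideal.Quotient.eq_zero_iff_mem, hαb, Algebra.smul_def]
    exact J.mul_mem_right _ (Ideal.mem_span_singleton_self _)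
  let _ : Module (R ⧸ m) (B ⧸ J) := htor.module
  have : IsScalarTower R (R ⧸ m) (B ⧸ J) := htor.isScalarTower
  let _ : Field (R ⧸ m) := Ideal.Quotient.field m
  let q : B →ₗ[R] (B ⧸ J) := (Ideal.Quotient.mkₐ R J).toLinearMap
  have hq : Function.Surjective q := Ideal.Quotient.mk_surjective
  have hqa : ∀ b, q b = 0 ↔ ∃ c, b = a • c := fun b => by
    change Ideal.Quotient.mk J b = 0 ↔ _
    rw [Ideal.Quotient.eq_zero_iff_mem, hJ, Ideal.mem_span_singleton']
    simp [Algebra.smul_def, mul_comm, eq_comm]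
  -- Lifts `e'` of a basis of `B / aB`, together with `aB`, generate `B` over `R`. In a relation `∑
  -- r_l e'_l + a b = 0` all `r_l` lie in `m`, so they are `α` of elements of `R₁`, and `a` can be
  -- cancelled: the relations are parametrised by `ι →₀ R₁`.
  let e := Module.Basis.ofVectorSpace (R ⧸ m) (B ⧸ J)
  set ι := Module.Basis.ofVectorSpaceIndex (R ⧸ m) (B ⧸ J)
  choose e' he' using fun l => hq (e l)
  -- the presentation `(ι →₀ R₁) → (ι →₀ R) × B → B`
  let f : (ι →₀ R) × B →ₗ[R] B :=
    (Finsupp.linearCombination R e').coprod (LinearMap.lsmul R B a)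
  let L : (ι →₀ R₁) →ₗ[R] B := (Finsupp.linearCombination R₁ e').restrictScalars R
  let g : (ι →₀ R₁) →ₗ[R] (ι →₀ R) × B :=
    (Finsupp.mapRange.linearMap α).prod (-L)
  have haL : ∀ s, Finsupp.linearCombination R e' (Finsupp.mapRange.linearMap α s) = a • L s := by
    intro s
    simp only [L, LinearMap.restrictScalars_apply]
    induction s using Finsupp.induction_linear with
    | zero => simp
    | add s t hs ht => simp only [map_add, hs, ht, smul_add]
    | single i s => simp [hαb]
  have hqlin : ∀ r : ι →₀ R, q (Finsupp.linearCombination R e' r) =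
      Finsupp.linearCombination (R ⧸ m) e (Finsupp.mapRange.linearMap m.mkQ r) := by
    intro r
    induction r using Finsupp.induction_linear with
    | zero => simp
    | add s t hs ht => simp only [map_add, hs, ht]
    | single i s =>
      simp only [Finsupp.linearCombination_single, map_smul, he', Finsupp.mapRange.linearMap_apply,
        Finsupp.mapRange_single]
      rfl
  have hexact : Function.Exact g f := by
    rintro ⟨r, b⟩
    constructor
    · intro hrb
      have hrb : Finsupp.linearCombination R e' r + a • b = 0 := hrb
      have h0 : q (Finsupp.linearCombination R e' r) = 0 :=
        (hqa _).2 ⟨-b, by rw [smul_neg]; exact eq_neg_of_add_eq_zero_left hrb⟩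
      rw [hqlin] at h0
      have h0 := (map_eq_zero_iff _ (Module.Basis.linearIndependent e)).1 h0
      have hr : ∀ l, r l ∈ m := fun l => by
        have := DFunLike.congr_fun h0 l
        simpa [Ideal.Quotient.eq_zero_iff_mem] using this
      choose σ hσ using fun l => hrange (r l) (hr l)
      let s : ι →₀ R₁ := ∑ l ∈ r.support, Finsupp.single l (σ l)
      have hs : Finsupp.mapRange.linearMap α s = r := by
        simp only [s, map_sum, Finsupp.mapRange.linearMap_apply, Finsupp.mapRange_single, hσ]
        exact r.sum_single
      refine ⟨s, Prod.ext hs ?_⟩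
      have : a • (b + L s) = 0 := by rw [smul_add, ← haL, hs, add_comm]; exact hrb
      exact (eq_neg_of_add_eq_zero_left (ha _ this)).symm
    · rintro ⟨s, hs⟩
      rw [← hs]
      change Finsupp.linearCombination R e' (Finsupp.mapRange.linearMap α s) + a • (-L s) = 0
      rw [haL]; simp
  have hf : Function.Surjective f := by
    intro b
    obtain ⟨r, hr⟩ := (Finsupp.mapRange_surjective (α := ι) m.mkQ (map_zero _)
      (Submodule.mkQ_surjective m)) (e.repr (q b))
    have h1 : q (Finsupp.linearCombination R e' r) = q b := by
      rw [hqlin, Finsupp.mapRange.linearMap_apply, hr, e.linearCombination_repr]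
    obtain ⟨c, hc⟩ := (hqa (b - Finsupp.linearCombination R e' r)).1 (by rw [map_sub, h1, sub_self])
    exact ⟨(r, c), by simp [f, ← hc]⟩
  have hB := lTensor_exact B hexact hf
  have hz : f.lTensor B ((LinearMap.inr R (ι →₀ R) B).lTensor B t) = 0 := by
    rw [← LinearMap.lTensor_comp_apply]
    have : f ∘ₗ LinearMap.inr R (ι →₀ R) B = a • LinearMap.id := by ext b; simp [f]
    rw [this, LinearMap.lTensor_smul]
    simpa using ht
  obtain ⟨z, hz⟩ := (hB _).1 hz
  -- coordinates of `z`
  let Θ : B ⊗[R] (ι →₀ R₁) →ₗ[R] (ι →₀ B) := TensorProduct.lift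
    (LinearMap.mk₂ R (fun b s => s.mapRange (fun c : R₁ => c • b) (zero_smul _ _))
      (fun b b' s => by ext l; simp) (fun r b s => by ext l; exact smul_comm _ _ _)
      (fun b s s' => by ext l; simp [add_smul]) (fun r b s => by ext l; simp))
  let Θ' : B ⊗[R] (ι →₀ R) →ₗ[R] (ι →₀ B) := TensorProduct.lift
    (LinearMap.mk₂ R (fun b s => s.mapRange (fun c : R => c • b) (zero_smul _ _))
      (fun b b' s => by ext l; simp) (fun r b s => by ext l; exact smul_comm _ _ _)
      (fun b s s' => by ext l; simp [add_smul]) (fun r b s => by ext l; simp [mul_smul]))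
  -- `Θ` and `Θ'` multiply coordinates into `B`. Since `α` is multiplication by `a`, which is
  -- regular on `B`, vanishing of the first component of the relation forces `Θ z = 0`.
  have hΘ : ∀ z, Θ' ((Finsupp.mapRange.linearMap α).lTensor B z) = a • Θ z := by
    intro z
    induction z using TensorProduct.induction_on with
    | zero => simp
    | add z z' h h' => simp only [map_add, h, h', smul_add]
    | tmul b s => ext l; simp [Θ, Θ', hαb]
  have hfst : (Finsupp.mapRange.linearMap α).lTensor B z = 0 := by
    have := congrArg ((LinearMap.fst R (ι →₀ R) B).lTensor B) hz
    rw [← LinearMap.lTensor_comp_apply, ← LinearMap.lTensor_comp_apply] at this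
    have h2 : LinearMap.fst R (ι →₀ R) B ∘ₗ g = Finsupp.mapRange.linearMap α := rfl
    rw [h2] at this
    rw [this]; simp
  have hΘz : Θ z = 0 := by
    have h0 : a • Θ z = 0 := by rw [← hΘ, hfst, map_zero]
    ext l
    exact ha _ (DFunLike.congr_fun h0 l)
  have hsnd : t = -(L.lTensor B z) := by
    have := congrArg ((LinearMap.snd R (ι →₀ R) B).lTensor B) hz
    rw [← LinearMap.lTensor_comp_apply, ← LinearMap.lTensor_comp_apply] at this
    have h2 : LinearMap.snd R (ι →₀ R) B ∘ₗ g = -L := rfl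
    rw [h2, LinearMap.snd_comp_inr, LinearMap.lTensor_id, LinearMap.lTensor_neg] at this
    exact this.symm
  -- Over `R₁` the coefficients of `L` cross the tensor sign, so the image of `L z` depends only on
  -- the products recorded by `Θ z`.
  let Ψ : (ι →₀ B) →+ B ⊗[R₁] B := Finsupp.liftAddHom fun l =>
    ((TensorProduct.mk R₁ B B).flip (e' l)).toAddMonoidHom
  have hΨ : ∀ z, TensorProduct.mapOfCompatibleSMul R₁ R R B B (L.lTensor B z) = Ψ (Θ z) := by
    intro z
    induction z using TensorProduct.induction_on with
    | zero => simp
    | add z z' h h' => simp only [map_add, h, h']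
    | tmul b s =>
      induction s using Finsupp.induction_linear with
      | zero => simp
      | add s s' h h' => simp only [TensorProduct.tmul_add, map_add, h, h']
      | single l s => simp [L, Θ, Ψ, TensorProduct.smul_tmul']
  rw [hsnd, map_neg, hΨ, hΘz, map_zero, neg_zero]

/-- Since `m B ⊆ a B`, one can write `x = r + a w`. Then `a` kills `w ⊗ 1 - 1 ⊗ w` over `R`, so this
difference vanishes over `R₁`: membership for `R` is traded for membership for `R₁`. -/
theorem exists_eq_add_smul_of_mem_strictClosure (m : Ideal R) [m.IsMaximal] (a : R)
    (α : R₁ →ₗ[R] R) (hα : ∀ s, algebraMap R B (α s) = a • algebraMap R₁ B s)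
    (hrange : ∀ r ∈ m, ∃ s, α s = r)
    (ha : ∀ b : B, a • b = 0 → b = 0) (ha1 : ∀ b : B, a • b ≠ 1) {x : B}
    (hx : x ∈ strictClosure R B) :
    ∃ (r : R) (w : B), x = algebraMap R B r + a • w ∧ w ∈ strictClosure R₁ B := by
  obtain ⟨r, hr⟩ := exists_sub_mem_of_mem_strictClosure m (Ideal.span {algebraMap R B a})
    (fun h => by
      obtain ⟨b, hb⟩ := Ideal.mem_span_singleton'.1 ((Ideal.eq_top_iff_one _).1 h)
      exact ha1 b (by rw [Algebra.smul_def, mul_comm, hb]))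
    (fun r hr => by
      obtain ⟨s, rfl⟩ := hrange r hr
      rw [hα, Algebra.smul_def]
      exact Ideal.mul_mem_right _ _ (Ideal.mem_span_singleton_self _)) hx
  obtain ⟨w, hw⟩ := Ideal.mem_span_singleton'.1 hr
  have hw' : x = algebraMap R B r + a • w := by
    rw [Algebra.smul_def, mul_comm, hw]; ring
  refine ⟨r, w, hw', ?_⟩
  have haw : a • w ∈ strictClosure R B := by
    have : a • w = x - algebraMap R B r := by rw [hw']; ring
    rw [this]
    exact sub_mem hx ((strictClosure R B).algebraMap_mem r)
  have h0 : a • (w ⊗ₜ[R] (1 : B) - (1 : B) ⊗ₜ[R] w) = 0 := by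
    rw [smul_sub, TensorProduct.smul_tmul', ← TensorProduct.tmul_smul, sub_eq_zero]
    exact haw
  have := mapOfCompatibleSMul_eq_zero_of_smul_eq_zero m a α hα hrange ha _ h0
  rw [mem_strictClosure, ← sub_eq_zero]
  simpa using this

end BlowUpStep

/-! ### Integral dependence on ideals, and integrality from stable modules -/

section IntegralOverIdeal

/-- If `r = x s` with `x ∈ I` and `s` integral, then `r` is integral over `I`. -/
theorem isIntegralOverIdeal_of_eq_mul {A K : Type*} [CommRing A] [CommRing K] [Algebra A K]
    (hinj : Function.Injective (algebraMap A K)) {I : Ideal A} {x r : A} (hx : x ∈ I) {s : K}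
    (hs : IsIntegral A s) (hr : algebraMap A K r = algebraMap A K x * s) :
    IsIntegralOverIdeal I r := by
  obtain ⟨p, hp, hps⟩ := hs
  set d := p.natDegree with hd
  -- `p * X` in place of `p` keeps the degree of the equation positive even when `p` is constant.
  refine ⟨d + 1, fun i => x ^ i * (p * Polynomial.X).coeff (d + 1 - i), by omega, ?_, ?_⟩
  · intro i _
    exact Ideal.mul_mem_right _ _ (Ideal.pow_mem_pow hx i)
  · apply hinj
    have hev : ∑ j ∈ Finset.range (d + 1 + 1), algebraMap A K ((p * Polynomial.X).coeff j) * s ^ j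
        = 0 := by
      have h0 : Polynomial.aeval s (p * Polynomial.X) = 0 := by
        rw [map_mul, Polynomial.aeval_def, hps, zero_mul]
      have hdeg : (p * Polynomial.X).natDegree < d + 1 + 1 := by
        refine lt_of_le_of_lt Polynomial.natDegree_mul_le ?_
        have := Polynomial.natDegree_X_le (R := A)
        omega
      rw [Polynomial.aeval_eq_sum_range' hdeg] at h0
      simpa only [Algebra.smul_def] using h0
    rw [Finset.sum_range_succ, Polynomial.coeff_mul_X, hd, hp.coeff_natDegree, map_one, one_mul,
      ← hd] at hev
    have hrefl : ∑ i ∈ Finset.Icc 1 (d + 1),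
        algebraMap A K ((p * Polynomial.X).coeff (d + 1 - i)) * s ^ (d + 1 - i) =
        ∑ j ∈ Finset.range (d + 1), algebraMap A K ((p * Polynomial.X).coeff j) * s ^ j := by
      refine Finset.sum_nbij' (fun i => d + 1 - i) (fun j => d + 1 - j) ?_ ?_ ?_ ?_ ?_ <;>
        simp only [Finset.mem_Icc, Finset.mem_range] <;> intros <;> first | omega | trivial
    rw [← hrefl] at hev
    rw [map_zero, map_add, map_sum, map_pow, hr, mul_pow]
    have : ∑ i ∈ Finset.Icc 1 (d + 1), algebraMap A K
        (x ^ i * (p * Polynomial.X).coeff (d + 1 - i) * r ^ (d + 1 - i)) =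
        algebraMap A K x ^ (d + 1) * ∑ i ∈ Finset.Icc 1 (d + 1),
        algebraMap A K ((p * Polynomial.X).coeff (d + 1 - i)) * s ^ (d + 1 - i) := by
      rw [Finset.mul_sum]
      refine Finset.sum_congr rfl fun i hi => ?_
      rw [Finset.mem_Icc] at hi
      rw [map_mul, map_mul, map_pow, map_pow, hr, mul_pow]
      conv_rhs => rw [← Nat.add_sub_cancel' hi.2, pow_add, Nat.add_sub_cancel' hi.2]
      ring
    rw [this, ← mul_add, add_comm (s ^ _), hev, mul_zero]

theorem isIntegrallyClosedIdeal_of_isPrime {A : Type*} [CommRing A] (P : Ideal A) [P.IsPrime] :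
    IsIntegrallyClosedIdeal P := by
  rintro x ⟨n, a, hn, ha, h⟩
  have hsum : ∑ i ∈ Finset.Icc 1 n, a i * x ^ (n - i) ∈ P := by
    refine Ideal.sum_mem _ fun i hi => Ideal.mul_mem_right _ _ ?_
    exact Ideal.pow_le_self (by rw [Finset.mem_Icc] at hi; omega) (ha i hi)
  have : x ^ n ∈ P := by
    rw [eq_neg_of_add_eq_zero_left h]
    exact neg_mem hsum
  exact ‹P.IsPrime›.mem_of_pow_mem n this

theorem IsIntegralOverIdeal.map {A B : Type*} [CommRing A] [CommRing B] (f : A →+* B)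
    {I : Ideal A} {J : Ideal B} (hIJ : ∀ x ∈ I, f x ∈ J) {x : A} (hx : IsIntegralOverIdeal I x) :
    IsIntegralOverIdeal J (f x) := by
  obtain ⟨n, a, hn, ha, h⟩ := hx
  have hmap : I.map f ≤ J := Ideal.map_le_iff_le_comap.2 hIJ
  refine ⟨n, fun i => f (a i), hn, fun i hi => ?_, ?_⟩
  · have := Ideal.mem_map_of_mem f (ha i hi)
    rw [Ideal.map_pow] at this
    exact Ideal.pow_right_mono hmap i this
  · simpa using congrArg f h

end IntegralOverIdeal

/-- An element stabilising a finitely generated submodule that contains `1` is integral. -/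
theorem isIntegral_of_mul_mem {C K : Type*} [CommRing C] [IsNoetherianRing C] [CommRing K]
    [Algebra C K] (N : Submodule C K) (hN : N.FG) (h1 : (1 : K) ∈ N) {x : K}
    (hx : ∀ y ∈ N, x * y ∈ N) : IsIntegral C x := by
  have hle : Subalgebra.toSubmodule (Algebra.adjoin C {x}) ≤ N := by
    intro z hz
    obtain ⟨p, rfl⟩ := Algebra.adjoin_singleton_eq_range_aeval C x ▸ hz
    have hpow : ∀ n : ℕ, x ^ n ∈ N := by
      intro n
      induction n with
      | zero => simpa using h1
      | succ n ih => rw [pow_succ']; exact hx _ ih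
    change Polynomial.aeval x p ∈ N
    rw [Polynomial.aeval_eq_sum_range]
    exact Submodule.sum_mem _ fun i _ => N.smul_mem _ (hpow i)
  have : IsNoetherian C N := isNoetherian_of_fg_of_noetherian N hN
  have hfg : (Subalgebra.toSubmodule (Algebra.adjoin C {x})).FG := by
    have := (isNoetherian_submodule.1 this) _ hle
    exact this
  exact IsIntegral.of_mem_of_fg _ hfg x (Algebra.self_mem_adjoin_singleton C x)

/-! ### Arf subalgebras and their blow-ups -/

variable {C K : Type*} [CommRing C] [CommRing K] [Algebra C K]

/-- The Arf property of an integral extension `R` of `C` inside `K`, where `K` plays the role of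
the total ring of fractions of `R`. -/
structure IsArfIn (R : Subalgebra C K) : Prop where
  isIntegral : ∀ x ∈ R, IsIntegral C x
  weaklyArf : ∀ x ∈ R, IsUnit x → ∀ v w, IsIntegral C v → IsIntegral C w →
    x * v ∈ R → x * w ∈ R → x * v * w ∈ R
  exists_dvd : ∀ J : Ideal R, (∃ b ∈ J, IsUnit (b : K)) → IsIntegrallyClosedIdeal J →
    ∃ c ∈ J, ∀ y ∈ J, ∃ v, IsIntegral C v ∧ (y : K) = c * v

/-- The algebra `a⁻¹ m`, where `a` is a unit of `K` and `m` is an ideal of `R` with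
`a ∈ m` and `m² = a m`. -/
def blowUp (R : Subalgebra C K) (m : Ideal R) (a : R) (ha : a ∈ m)
    (hmul : ∀ y z : R, y ∈ m → z ∈ m → ∀ v w : K, (y : K) = a * v → (z : K) = a * w →
      ∃ t ∈ m, (t : K) = a * (v * w)) : Subalgebra C K where
  carrier := {k | ∃ r ∈ m, (r : K) = a * k}
  mul_mem' := by
    rintro v w ⟨y, hy, hyv⟩ ⟨z, hz, hzw⟩
    exact hmul y z hy hz v w hyv hzw
  add_mem' := by
    rintro v w ⟨y, hy, hyv⟩ ⟨z, hz, hzw⟩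
    exact ⟨y + z, add_mem hy hz, by push_cast; rw [hyv, hzw, mul_add]⟩
  algebraMap_mem' c := ⟨a * algebraMap C R c, m.mul_mem_right _ ha, rfl⟩

/-- Relative strict closedness of subalgebras `R ≤ B`. -/
def IsStrictlyClosedIn (R B : Subalgebra C K) (h : R ≤ B) : Prop :=
  letI := (Subalgebra.inclusion h).toRingHom.toAlgebra
  ∀ x ∈ strictClosure R B, (x : K) ∈ R

namespace IsArfIn

variable {R : Subalgebra C K} (hR : IsArfIn R)

theorem mem_of_eq_mul {m : Ideal R} (hm : IsIntegrallyClosedIdeal m) {a r : R} (ha : a ∈ m) {v : K}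
    (hv : IsIntegral C v) (hr : (r : K) = a * v) : r ∈ m :=
  hm r (isIntegralOverIdeal_of_eq_mul (K := K) Subtype.val_injective ha hv.tower_top hr)

-- This makes `a⁻¹ m` a ring: `a v w` is in `R` by the weak Arf property, and it is `y w` with `y ∈
-- m` and `w` integral, hence in the integrally closed ideal `m`.
include hR in
theorem exists_mem_eq_mul_mul {m : Ideal R} (hm : IsIntegrallyClosedIdeal m) {a : R}
    (hau : IsUnit (a : K)) (hdvd : ∀ y ∈ m, ∃ v, IsIntegral C v ∧ (y : K) = a * v)
    {y z : R} (hy : y ∈ m) (hz : z ∈ m) {v w : K} (hv : (y : K) = a * v)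
    (hw : (z : K) = a * w) : ∃ t ∈ m, (t : K) = a * (v * w) := by
  obtain ⟨v', hv', h1⟩ := hdvd y hy
  obtain ⟨w', hw', h2⟩ := hdvd z hz
  obtain rfl : v = v' := hau.mul_left_cancel (hv.symm.trans h1)
  obtain rfl : w = w' := hau.mul_left_cancel (hw.symm.trans h2)
  have := hR.weaklyArf a a.2 hau v w hv' hw' (hv ▸ y.2) (hw ▸ z.2)
  refine ⟨⟨_, this⟩, mem_of_eq_mul hm hy hw' ?_, mul_assoc _ _ _⟩
  rw [hv]

-- The weak Arf property is inherited after scaling by `a`. An integrally closed `J` is moved to the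
-- ideal `a J ⊆ m` of `R`. An element integral over `a J` lies in `m`, so it is `a v` with `v` in
-- the blow-up, and dividing its equation by `a ^ n` puts `v` in `J`. Hence `a J` is integrally
-- closed, and a divisor `a j` of all its elements yields `j` for `J`.
include hR in
theorem blowUp {m : Ideal R} (hm : IsIntegrallyClosedIdeal m) {a : R} (ha : a ∈ m)
    (hau : IsUnit (a : K)) (hdvd : ∀ y ∈ m, ∃ v, IsIntegral C v ∧ (y : K) = a * v) (hmul) :
    IsArfIn (blowUp R m a ha hmul) where
  isIntegral := by
    rintro x ⟨r, hr, hx⟩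
    obtain ⟨v, hv, h⟩ := hdvd r hr
    exact hau.mul_left_cancel (hx.symm.trans h) ▸ hv
  weaklyArf := by
    rintro x ⟨x', hx', hx⟩ hxu v w hv hw ⟨y', hy', hy⟩ ⟨z', hz', hz⟩
    have hx'u : IsUnit (x' : K) := hx ▸ hau.mul hxu
    have h1 : (x' : K) * v * w ∈ R := by
      refine hR.weaklyArf x' x'.2 hx'u v w hv hw ?_ ?_
      · rw [hx, mul_assoc, ← hy]; exact y'.2
      · rw [hx, mul_assoc, ← hz]; exact z'.2
    refine ⟨⟨_, h1⟩, ?_, ?_⟩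
    · exact mem_of_eq_mul hm hx' (hv.mul hw) (mul_assoc _ _ _)
    · change (x' : K) * v * w = _
      rw [hx]; ring
  exists_dvd := by
    set R₁ := StrictClosedness.blowUp R m a ha hmul
    rintro J ⟨b, hb, hbu⟩ hJ
    have hRR₁ : ∀ r : R, (r : K) ∈ R₁ := fun r => ⟨a * r, m.mul_mem_right _ ha, rfl⟩
    have hdown : ∀ s : R₁, ∃ r ∈ m, (r : K) = a * s := fun s => s.2
    -- the ideal `a ^ i J` of `R`
    let D : ℕ → Ideal R₁ → Ideal R := fun i L =>
      { carrier := {r | ∃ j ∈ L, (r : K) = (a : K) ^ i * (j : K)}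
        zero_mem' := ⟨0, L.zero_mem, by simp⟩
        add_mem' := by
          rintro r s ⟨j, hj, h⟩ ⟨k, hk, h'⟩
          exact ⟨j + k, add_mem hj hk, by push_cast; rw [h, h', mul_add]⟩
        smul_mem' := by
          rintro r s ⟨j, hj, h⟩
          refine ⟨⟨r, hRR₁ r⟩ * j, L.mul_mem_left _ hj, ?_⟩
          simp only [smul_eq_mul, MulMemClass.coe_mul, h]
          ring }
    have hDpow : ∀ i, D 1 J ^ i ≤ D i (J ^ i) := by
      intro i
      induction i with
      | zero =>
        intro r _
        exact ⟨⟨r, hRR₁ r⟩, by simp, by simp⟩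
      | succ i ih =>
        rw [pow_succ, Ideal.mul_le]
        intro r hr s hs
        obtain ⟨j, hj, h⟩ := ih hr
        obtain ⟨k, hk, h'⟩ := hs
        refine ⟨j * k, by rw [pow_succ]; exact Ideal.mul_mem_mul hj hk, ?_⟩
        push_cast
        rw [h, h']; ring
    have hclosed : IsIntegrallyClosedIdeal (D 1 J) := by
      rintro x ⟨n, c, hn, hc, hx⟩
      have hDm : D 1 J ≤ m := by
        rintro r ⟨j, hj, h⟩
        obtain ⟨t, ht, h2⟩ := hdown j
        have : r = t := Subtype.ext (by rw [h, h2, pow_one])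
        exact this ▸ ht
      have hxm : x ∈ m := by
        refine hm x ⟨n, c, hn, fun i hi => Ideal.pow_right_mono hDm i (hc i hi), hx⟩
      obtain ⟨v, -, hv⟩ := hdvd x hxm
      have hvR₁ : v ∈ R₁ := ⟨x, hxm, hv⟩
      have hd : ∀ i, ∃ d : R₁, i ∈ Finset.Icc 1 n → d ∈ J ^ i ∧ (c i : K) = (a : K) ^ i * d := by
        intro i
        by_cases hi : i ∈ Finset.Icc 1 n
        · obtain ⟨d, hd, h⟩ := hDpow i (hc i hi)
          exact ⟨d, fun _ => ⟨hd, h⟩⟩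
        · exact ⟨0, fun h => absurd h hi⟩
      choose d hd using hd
      refine ⟨⟨v, hvR₁⟩, hJ _ ⟨n, d, hn, fun i hi => (hd i hi).1, ?_⟩, by simpa using hv⟩
      apply Subtype.ext
      apply (hau.pow n).mul_left_cancel
      have hx' := congrArg (fun t : R => (t : K)) hx
      push_cast at hx' ⊢
      rw [mul_zero, ← hx', mul_add, hv, mul_pow, Finset.mul_sum]
      congr 1
      refine Finset.sum_congr rfl fun i hi => ?_
      rw [(hd i hi).2, mul_pow]
      rw [Finset.mem_Icc] at hi
      conv_lhs => rw [← Nat.add_sub_cancel' hi.2, pow_add, Nat.add_sub_cancel' hi.2]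
      ring
    obtain ⟨t, ht, htb⟩ := hdown b
    obtain ⟨c, ⟨j, hj, hc⟩, hcdvd⟩ := hR.exists_dvd (D 1 J)
      ⟨t, ⟨b, hb, by rw [htb, pow_one]⟩, htb ▸ hau.mul hbu⟩ hclosed
    refine ⟨j, hj, fun y hy => ?_⟩
    obtain ⟨s, hs, hsy⟩ := hdown y
    obtain ⟨v, hv, h⟩ := hcdvd s ⟨y, hy, by rw [hsy, pow_one]⟩
    refine ⟨v, hv, hau.mul_left_cancel ?_⟩
    rw [← hsy, h, hc, pow_one, mul_assoc]

end IsArfIn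

/-! ### Induction along blow-ups -/

variable {C K : Type*} [CommRing C] [CommRing K] [Algebra C K]

/-- If `R₁` is the blow-up of `R` at a maximal ideal and is strictly closed in `B`, then `R` is
strictly closed in `B`. -/
theorem IsStrictlyClosedIn.of_blowUp {R B : Subalgebra C K} {m : Ideal R} [m.IsMaximal] {a : R}
    {ha : a ∈ m} {hmul} (hau : IsUnit (a : K)) (hdvd : ∀ y ∈ m, ∃ v : K, (y : K) = a * v)
    (hRB : R ≤ B) (hB : ∀ v ∈ B, IsIntegral C v) (hR₁B : blowUp R m a ha hmul ≤ B)
    (h : IsStrictlyClosedIn (blowUp R m a ha hmul) B hR₁B) : IsStrictlyClosedIn R B hRB := by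
  set R₁ := blowUp R m a ha hmul
  have hRR₁ : R ≤ R₁ := fun r hr => ⟨a * ⟨r, hr⟩, m.mul_mem_right _ ha, rfl⟩
  let _ : Algebra R B := (Subalgebra.inclusion hRB).toRingHom.toAlgebra
  let _ : Algebra R₁ B := (Subalgebra.inclusion hR₁B).toRingHom.toAlgebra
  let _ : Algebra R R₁ := (Subalgebra.inclusion hRR₁).toRingHom.toAlgebra
  have : IsScalarTower R R₁ B := .of_algebraMap_eq' rfl
  have hmap : ∀ r : R, ((algebraMap R B r : B) : K) = r := fun _ => rfl
  have hmap₁ : ∀ r : R₁, ((algebraMap R₁ B r : B) : K) = r := fun _ => rfl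
  have hmap₂ : ∀ r : R, ((algebraMap R R₁ r : R₁) : K) = r := fun _ => rfl
  have hmem : ∀ s : R₁, ∃ r ∈ m, (r : K) = a * s := fun s => s.2
  let α : R₁ →ₗ[R] R :=
    { toFun := fun s => ⟨a * s, by obtain ⟨r, -, h⟩ := hmem s; exact h ▸ r.2⟩
      map_add' := fun s t => Subtype.ext (by simp [mul_add])
      map_smul' := fun r s => Subtype.ext (by
        simp [Algebra.smul_def, hmap₂, mul_left_comm]) }
  have hα : ∀ s, (α s : K) = a * s := fun _ => rfl
  intro x hx
  obtain ⟨r, w, hxr, hw⟩ := exists_eq_add_smul_of_mem_strictClosure m a α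
    (fun s => Subtype.ext (by rw [hmap, hα, Algebra.smul_def]; rfl))
    (fun r hr => by
      obtain ⟨v, hv⟩ := hdvd r hr
      exact ⟨⟨v, r, hr, hv⟩, Subtype.ext hv.symm⟩)
    (fun b hb => by
      rw [Algebra.smul_def] at hb
      have : (a : K) * (b : K) = 0 := congrArg (fun t : B => (t : K)) hb
      exact Subtype.ext (hau.mul_left_cancel (this.trans (mul_zero _).symm)))
    -- If `a b = 1` with `b` integral, then `1` is integral over `m`, hence in `m`.
    (fun b hb => by
      rw [Algebra.smul_def] at hb
      have : (1 : K) = (a : K) * (b : K) := (congrArg (fun t : B => (t : K)) hb).symm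
      have h1 := IsArfIn.mem_of_eq_mul (r := 1) (isIntegrallyClosedIdeal_of_isPrime m) ha
        (hB b b.2) this
      exact ‹m.IsMaximal›.ne_top ((Ideal.eq_top_iff_one m).2 h1)) hx
  have hwR₁ : (w : K) ∈ R₁ := h w hw
  obtain ⟨t, -, ht⟩ := hmem ⟨w, hwR₁⟩
  have : (x : K) = r + t := by
    rw [hxr, ht, Algebra.smul_def]; rfl
  rw [this]
  exact add_mem r.2 t.2

/-- The number of blow-ups needed is controlled by the length of `B / R`. -/
theorem length_map_mkQ_blowUp_lt [IsNoetherianRing C] {R B : Subalgebra C K} {m : Ideal R}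
    [m.IsMaximal] {a : R} {ha : a ∈ m} {hmul} (hRB : R ≤ B) (hB : (Subalgebra.toSubmodule B).FG)
    (hB₁ : (Subalgebra.toSubmodule (B ⊔ blowUp R m a ha hmul)).FG)
    (hcond : ∀ r : R, (∀ b ∈ B, (r : K) * b ∈ R) → r ∈ m)
    (hlen : Module.length C ((Subalgebra.toSubmodule B).map (Subalgebra.toSubmodule R).mkQ) ≠ ⊤) :
    Module.length C ((Subalgebra.toSubmodule (B ⊔ blowUp R m a ha hmul)).map
      (Subalgebra.toSubmodule (blowUp R m a ha hmul)).mkQ) <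
    Module.length C ((Subalgebra.toSubmodule B).map (Subalgebra.toSubmodule R).mkQ) := by
  set R₁ := blowUp R m a ha hmul
  have hmem : ∀ s : R₁, ∃ r ∈ m, (r : K) = a * s := fun s => s.2
  let Bs : Submodule R K :=
    { Subalgebra.toSubmodule B with
      smul_mem' := fun r b hb => B.mul_mem (hRB r.2) hb }
  have hBs : Bs.FG := Submodule.FG.of_restrictScalars C hB
  let Rs : Submodule R K :=
    { Subalgebra.toSubmodule R with
      smul_mem' := fun r b hb => R.mul_mem r.2 hb }
  -- multiplication by `a` maps `B R₁` into `m B`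
  have hmB : ∀ k ∈ B ⊔ R₁, (a : K) * k ∈ m • Bs := by
    intro k hk
    rw [← Subalgebra.mem_toSubmodule, ← Subalgebra.mul_toSubmodule] at hk
    induction hk using Submodule.mul_induction_on' with
    | mem_mul_mem b hb s hs =>
      obtain ⟨r, hr, h⟩ := hmem ⟨s, hs⟩
      have : (a : K) * (b * s) = r • b := by
        rw [Subalgebra.smul_def, smul_eq_mul, h]; ring
      rw [this]
      exact Submodule.smul_mem_smul hr hb
    | add x _ y _ hx hy => rw [mul_add]; exact add_mem hx hy
  have hmB' : ∀ k ∈ B ⊔ R₁, (a : K) * k ∈ B := fun k hk =>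
    (Submodule.smul_le_right : m • Bs ≤ Bs) (hmB k hk)
  -- Multiplication by `a` sends `B R₁ / R₁` to `B / R`. It is injective: if `k` is integral and `a
  -- k ∈ R`, then `a k ∈ m`, so `k ∈ R₁`.
  let u : (K ⧸ Subalgebra.toSubmodule R₁) →ₗ[C] (K ⧸ Subalgebra.toSubmodule R) :=
    Submodule.mapQ _ _ (LinearMap.mulLeft C (a : K)) (fun k hk => by
      obtain ⟨r, hr, h⟩ := hmem ⟨k, hk⟩
      exact (h ▸ r.2 : (a : K) * k ∈ R))
  let v : ((Subalgebra.toSubmodule (B ⊔ R₁)).map (Subalgebra.toSubmodule R₁).mkQ) →ₗ[C]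
      ((Subalgebra.toSubmodule B).map (Subalgebra.toSubmodule R).mkQ) :=
    u.restrict (by
      rintro _ ⟨k, hk, rfl⟩
      exact ⟨a * k, hmB' k hk, rfl⟩)
  have hinj : Function.Injective v := by
    rw [← LinearMap.ker_eq_bot, LinearMap.ker_eq_bot']
    rintro ⟨_, k, hk, rfl⟩ h
    have h' : (Subalgebra.toSubmodule R).mkQ ((a : K) * k) = 0 := congrArg Subtype.val h
    rw [Submodule.mkQ_apply, Submodule.Quotient.mk_eq_zero] at h'
    apply Subtype.ext
    change (Subalgebra.toSubmodule R₁).mkQ k = 0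
    rw [Submodule.mkQ_apply, Submodule.Quotient.mk_eq_zero]
    refine ⟨⟨_, h'⟩, ?_, rfl⟩
    exact IsArfIn.mem_of_eq_mul (isIntegrallyClosedIdeal_of_isPrime m) ha
      (IsIntegral.of_mem_of_fg _ hB₁ k hk) rfl
  -- The image comes from `m B`. Surjectivity would give `B ⊆ R + m B`, and Nakayama an `r ≡ 1`
  -- modulo `m` with `r B ⊆ R`, although the conductor lies in `m`.
  have hrange : LinearMap.range v ≠ ⊤ := by
    intro htop
    have hle : Bs ≤ Rs ⊔ m • Bs := by
      intro b hb
      obtain ⟨⟨_, k, hk, rfl⟩, h⟩ := LinearMap.range_eq_top.1 htop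
        ⟨(Subalgebra.toSubmodule R).mkQ b, b, hb, rfl⟩
      have h' : (Subalgebra.toSubmodule R).mkQ ((a : K) * k) =
        (Subalgebra.toSubmodule R).mkQ b := congrArg Subtype.val h
      rw [Submodule.mkQ_apply, Submodule.mkQ_apply, eq_comm, Submodule.Quotient.eq] at h'
      rw [← sub_add_cancel b ((a : K) * k)]
      exact Submodule.add_mem_sup (S := Rs) h' (hmB k hk)
    obtain ⟨r, hr, hle'⟩ := Submodule.exists_sub_one_mem_and_smul_le_of_fg_of_le_sup hBs le_rfl hle
    have hrm : r ∈ m := hcond r fun b hb => hle' (Submodule.smul_mem_pointwise_smul b r Bs hb)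
    exact ‹m.IsMaximal›.ne_top ((Ideal.eq_top_iff_one m).2
      (by simpa using sub_mem hrm hr))
  obtain ⟨_, _⟩ := isFiniteLength_iff_isNoetherian_isArtinian.1 (Module.length_ne_top_iff.1 hlen)
  have hinj' : Function.Injective v.rangeRestrict := fun x y h => hinj (congrArg Subtype.val h)
  exact (Module.length_le_of_injective v.rangeRestrict hinj').trans_lt (Submodule.length_lt hrange)

/-- Unless `B ≤ R`, the conductor of `R` in `B` is a proper ideal containing a unit of `K`; blow up
a maximal ideal above it. The blow-up `R₁` may leave `B`, so the induction continues with `B ⊔ R₁`,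
which is why a larger `B'` appears in the conclusion. -/
theorem IsArfIn.exists_isStrictlyClosedIn [IsNoetherianRing C]
    (hcond : ∀ B : Subalgebra C K, (Subalgebra.toSubmodule B).FG →
      ∃ c : C, IsUnit (algebraMap C K c) ∧ ∀ b ∈ B, c • b ∈ (⊥ : Subalgebra C K)) (n : ℕ) :
    ∀ R B : Subalgebra C K, IsArfIn R → R ≤ B → (Subalgebra.toSubmodule B).FG →
      Module.length C ((Subalgebra.toSubmodule B).map (Subalgebra.toSubmodule R).mkQ) < n →
      ∃ (B' : Subalgebra C K) (h : R ≤ B'), B ≤ B' ∧ (∀ b ∈ B', IsIntegral C b) ∧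
        IsStrictlyClosedIn R B' h := by
  induction n with
  | zero => intro R B _ _ _ h; simp at h
  | succ n ih =>
    intro R B hR hRB hB hlen
    by_cases hBR : B ≤ R
    · exact ⟨B, hRB, le_rfl, fun b hb => IsIntegral.of_mem_of_fg _ hB b hb,
        fun x _ => hBR x.2⟩
    let cond : Ideal R :=
      { carrier := {r | ∀ b ∈ B, (r : K) * b ∈ R}
        zero_mem' := fun b _ => by simp
        add_mem' := fun hr hs b hb => by
          rw [Subalgebra.coe_add, add_mul]; exact add_mem (hr b hb) (hs b hb)
        smul_mem' := fun r s hs b hb => by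
          rw [smul_eq_mul, Subalgebra.coe_mul, mul_assoc]; exact mul_mem r.2 (hs b hb) }
    have hne : cond ≠ ⊤ := fun h => hBR fun b hb => by
      simpa using (Ideal.eq_top_iff_one _).1 h b hb
    obtain ⟨m, hm, hle⟩ := Ideal.exists_le_maximal cond hne
    have hmc : IsIntegrallyClosedIdeal m := isIntegrallyClosedIdeal_of_isPrime m
    obtain ⟨c, hcu, hc⟩ := hcond B hB
    have hcm : algebraMap C R c ∈ m := hle fun b hb => by
      have := hc b hb
      rw [Algebra.smul_def] at this
      exact bot_le (a := R) this
    obtain ⟨a, ha, hdvd⟩ := hR.exists_dvd m ⟨_, hcm, hcu⟩ hmc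
    have hau : IsUnit (a : K) := by
      obtain ⟨v, -, hv⟩ := hdvd _ hcm
      have : IsUnit ((a : K) * v) := by rw [← hv]; exact hcu
      exact isUnit_of_mul_isUnit_left this
    have hmul : ∀ y z : R, y ∈ m → z ∈ m → ∀ v w : K, (y : K) = a * v → (z : K) = a * w →
        ∃ t ∈ m, (t : K) = a * (v * w) := fun y z hy hz v w hv hw =>
      hR.exists_mem_eq_mul_mul hmc hau hdvd hy hz hv hw
    set R₁ := StrictClosedness.blowUp R m a ha hmul
    have hdvd' : ∀ y ∈ m, ∃ v : K, (y : K) = a * v := fun y hy =>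
      (hdvd y hy).imp fun _ h => h.2
    have hR₁fg : (Subalgebra.toSubmodule R₁).FG := by
      have : IsNoetherian C (Subalgebra.toSubmodule B) := isNoetherian_of_fg_of_noetherian _ hB
      refine Submodule.fg_of_fg_map_injective (LinearMap.mulLeft C (a : K))
        (fun x y h => hau.mul_left_cancel h) (isNoetherian_submodule.1 this _ ?_)
      rintro _ ⟨k, ⟨r, -, h⟩, rfl⟩
      exact hRB (h ▸ r.2 : (a : K) * k ∈ R)
    have hB₁fg : (Subalgebra.toSubmodule (B ⊔ R₁)).FG := by
      rw [← Subalgebra.mul_toSubmodule]; exact hB.mul hR₁fg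
    have hlt := length_map_mkQ_blowUp_lt hRB hB hB₁fg (fun r hr => hle hr) hlen.ne_top
    obtain ⟨B', h, hBB', hB', hs⟩ := ih R₁ (B ⊔ R₁) (hR.blowUp hmc ha hau hdvd hmul) le_sup_right
      hB₁fg (lt_of_lt_of_le hlt (Order.le_of_lt_add_one (by exact_mod_cast hlen)))
    exact ⟨B', hRB.trans (le_sup_left.trans hBB'), le_sup_left.trans hBB', hB',
      hs.of_blowUp hau hdvd' _ hB'⟩

/-! ### One-dimensional Arf rings are strictly closed -/

/-- The relation `x ⊗ 1 = 1 ⊗ x` already holds over a finitely generated subalgebra. -/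
theorem exists_fg_mem_strictClosure {R S : Type*} [CommRing R] [CommRing S] [Algebra R S] {x : S}
    (hx : x ∈ strictClosure R S) :
    ∃ (B : Subalgebra R S) (h : x ∈ B), B.FG ∧ (⟨x, h⟩ : B) ∈ strictClosure R B := by
  set A : Subalgebra R S := Algebra.adjoin R {x} with hA
  have hAfg : A.FG := ⟨{x}, by simp [hA]⟩
  have hxA : x ∈ A := Algebra.self_mem_adjoin_singleton R x
  -- Each application shrinks a single tensor factor, so a second one follows with the factors
  -- exchanged.
  obtain ⟨B, hAB, hB, h1⟩ := TensorProduct.Algebra.eq_of_fg_of_subtype_eq (N := S) hAfg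
    (t := (⟨x, hxA⟩ : A) ⊗ₜ[R] (1 : S)) (t' := (1 : A) ⊗ₜ[R] x) (by simpa using (mem_strictClosure x).1 hx)
  have h2 : (1 : S) ⊗ₜ[R] (⟨x, hAB hxA⟩ : B) = x ⊗ₜ[R] (1 : B) := by
    simpa using congrArg (TensorProduct.comm R B S) h1
  obtain ⟨B', hAB', hB', h3⟩ := TensorProduct.Algebra.eq_of_fg_of_subtype_eq (N := B) hAfg
    (t := (1 : A) ⊗ₜ[R] (⟨x, hAB hxA⟩ : B)) (t' := (⟨x, hxA⟩ : A) ⊗ₜ[R] (1 : B))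
    (by simpa using h2)
  have h4 := congrArg (TensorProduct.map
    (Subalgebra.inclusion (le_sup_right : B' ≤ B ⊔ B')).toLinearMap
    (Subalgebra.inclusion (le_sup_left : B ≤ B ⊔ B')).toLinearMap) h3
  refine ⟨B ⊔ B', (le_sup_left : B ≤ _) (hAB hxA), hB.sup hB', ?_⟩
  rw [mem_strictClosure, eq_comm]
  simpa using h4

theorem isIntegral_of_mul_mem_of_isUnit {C K : Type*} [CommRing C] [IsNoetherianRing C]
    [CommRing K] [Algebra C K] (N : Submodule C K) (hN : N.FG) {u : K} (hu : IsUnit u)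
    (huN : u ∈ N) {x : K} (hx : ∀ y ∈ N, x * y ∈ N) : IsIntegral C x := by
  obtain ⟨u, rfl⟩ := hu
  refine isIntegral_of_mul_mem (N.map (LinearMap.mulLeft C (↑u⁻¹ : K))) (hN.map _)
    ⟨u, huN, by simp⟩ ?_
  rintro _ ⟨y, hy, rfl⟩
  exact ⟨x * y, hx y hy, by simp [mul_left_comm]⟩

theorem mem_nonZeroDivisors_of_isUnit_algebraMap {C : Type*} [CommRing C] {x : C}
    (hx : IsUnit (algebraMap C (FractionRing C) x)) : x ∈ C⁰ :=
  mem_nonZeroDivisors_of_injective (IsFractionRing.injective C (FractionRing C))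
    hx.mem_nonZeroDivisors

/-- If `I ^ (n + 1) = c I ^ n` and `b ∈ I` is regular, then `c` divides `b ^ (n + 1)` and is a unit
of `Q(C)`. For `y ∈ I` the fraction `y / c` maps the finite module `I ^ n` into itself, and this
module contains the unit `b ^ n`, so `y / c` is integral. -/
theorem IsArf.isArfIn_bot {C : Type*} [CommRing C] (h : IsArf C) :
    IsArfIn (⊥ : Subalgebra C (FractionRing C)) where
  isIntegral := by
    intro x hx
    obtain ⟨c, rfl⟩ := Algebra.mem_bot.1 hx
    exact isIntegral_algebraMap
  weaklyArf := by
    intro x hx hxu v w hv hw hxv hxw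
    obtain ⟨x, rfl⟩ := Algebra.mem_bot.1 hx
    obtain ⟨y, hy⟩ := Algebra.mem_bot.1 hxv
    obtain ⟨z, hz⟩ := Algebra.mem_bot.1 hxw
    have hx0 := mem_nonZeroDivisors_of_isUnit_algebraMap hxu
    have e1 : IsLocalization.mk' (FractionRing C) y ⟨x, hx0⟩ = v :=
      IsLocalization.mk'_eq_iff_eq_mul.2 (by rw [hy, mul_comm])
    have e2 : IsLocalization.mk' (FractionRing C) z ⟨x, hx0⟩ = w :=
      IsLocalization.mk'_eq_iff_eq_mul.2 (by rw [hz, mul_comm])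
    obtain ⟨r, hr⟩ := h.weaklyArf ⟨x, hx0⟩ y z (e1 ▸ hv) (e2 ▸ hw)
    rw [Algebra.mem_bot]
    refine ⟨r, ?_⟩
    rw [hr, IsLocalization.mk'_eq_iff_eq_mul, map_mul, hy, hz]
    ring
  exists_dvd := by
    rintro J ⟨b, hb, hbu⟩ hJ
    have := h.isNoetherianRing
    set f := algebraMap C (⊥ : Subalgebra C (FractionRing C))
    have hsurj : ∀ y : (⊥ : Subalgebra C (FractionRing C)), ∃ c, f c = y := fun y => by
      obtain ⟨c, hc⟩ := Algebra.mem_bot.1 y.2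
      exact ⟨c, Subtype.ext hc⟩
    obtain ⟨b, rfl⟩ := hsurj b
    have hb' : b ∈ J.comap f := hb
    have hI : IsIntegrallyClosedIdeal (J.comap f) := fun x hx => hJ _ (hx.map f fun _ h => h)
    have hbu : IsUnit (algebraMap C (FractionRing C) b) := hbu
    have hb0 := mem_nonZeroDivisors_of_isUnit_algebraMap hbu
    obtain ⟨c, hc, n, hn⟩ := h.principalReduction (J.comap f) ⟨b, hb, hb0⟩ hI
    refine ⟨f c, hc, fun y hy => ?_⟩
    obtain ⟨y, rfl⟩ := hsurj y
    have hcu : IsUnit (algebraMap C (FractionRing C) c) := by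
      have : b ^ (n + 1) ∈ Ideal.span {c} * J.comap f ^ n := hn ▸ Ideal.pow_mem_pow hb' _
      obtain ⟨t, -, ht⟩ := Ideal.mem_span_singleton_mul.1 this
      refine isUnit_of_mul_isUnit_left (y := algebraMap C _ t) ?_
      rw [← map_mul, ht, map_pow]
      exact hbu.pow _
    obtain ⟨u, hu⟩ := hcu
    refine ⟨↑u⁻¹ * algebraMap C _ y, ?_, ?_⟩
    · refine isIntegral_of_mul_mem_of_isUnit
        (Submodule.map (Algebra.linearMap C (FractionRing C)) (J.comap f ^ n))
        ((IsNoetherian.noetherian _).map _) (hbu.pow n)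
        ⟨b ^ n, Ideal.pow_mem_pow hb' n, by simp⟩ ?_
      rintro _ ⟨t, ht, rfl⟩
      have : y * t ∈ Ideal.span {c} * J.comap f ^ n := by
        rw [← hn, pow_succ']; exact Ideal.mul_mem_mul hy ht
      obtain ⟨t', ht', e⟩ := Ideal.mem_span_singleton_mul.1 this
      refine ⟨t', ht', ?_⟩
      rw [Algebra.linearMap_apply, Algebra.linearMap_apply, mul_assoc, Units.eq_inv_mul_iff_mul_eq,
        hu, ← map_mul, e, map_mul]
    · change algebraMap C (FractionRing C) y = algebraMap C (FractionRing C) c * _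
      rw [← hu, Units.mul_inv_cancel_left]

/-- The quotient embeds in `c⁻¹ C / C`, an image of `C / c`, which has finite length because `c` is
regular and the dimension is at most one. -/
theorem length_map_mkQ_bot_ne_top {C : Type*} [CommRing C] [IsNoetherianRing C]
    [Ring.KrullDimLE 1 C] (B : Submodule C (FractionRing C)) {c : C} (hc : c ∈ C⁰)
    (hB : ∀ b ∈ B, c • b ∈ (⊥ : Subalgebra C (FractionRing C))) :
    Module.length C (B.map
      (Subalgebra.toSubmodule (⊥ : Subalgebra C (FractionRing C))).mkQ) ≠ ⊤ := by
  set N := Subalgebra.toSubmodule (⊥ : Subalgebra C (FractionRing C))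
  obtain ⟨u, hu⟩ := IsLocalization.map_units (FractionRing C) ⟨c, hc⟩
  have hu : (u : FractionRing C) = algebraMap C _ c := hu
  let g : (C ⧸ Ideal.span {c}) →ₗ[C] FractionRing C ⧸ N :=
    Submodule.liftQ _ (N.mkQ ∘ₗ LinearMap.mulLeft C (↑u⁻¹ : FractionRing C) ∘ₗ
      Algebra.linearMap C (FractionRing C)) (by
        rw [Ideal.span_le, Set.singleton_subset_iff]
        change N.mkQ (↑u⁻¹ * algebraMap C _ c) = 0
        rw [← hu, Units.inv_mul, Submodule.mkQ_apply, Submodule.Quotient.mk_eq_zero]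
        exact one_mem (⊥ : Subalgebra C (FractionRing C)))
  have hle : B.map N.mkQ ≤ LinearMap.range g := by
    rintro _ ⟨b, hb, rfl⟩
    obtain ⟨r, hr⟩ := Algebra.mem_bot.1 (hB b hb)
    refine ⟨Submodule.Quotient.mk r, ?_⟩
    change N.mkQ (↑u⁻¹ * algebraMap C _ r) = N.mkQ b
    rw [hr, Algebra.smul_def, ← hu, Units.inv_mul_cancel_left]
  have h1 := Module.length_ne_top_iff.2 (isFiniteLength_quotient_span_singleton C hc)
  have h2 := Module.length_le_of_surjective g.rangeRestrict g.surjective_rangeRestrict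
  have h3 := Module.length_le_of_injective (Submodule.inclusion hle)
    (Submodule.inclusion_injective hle)
  exact ne_top_of_le_ne_top h1 (h3.trans h2)

/-- A relation `x ⊗ 1 = 1 ⊗ x` lives over a finitely generated integral subalgebra. This is a finite
module with a common denominator, so the induction on length applies to it. -/
theorem IsArf.isStrictlyClosed {C : Type*} [CommRing C] [Ring.KrullDimLE 1 C] (h : IsArf C) :
    IsStrictlyClosed C := by
  have := h.isNoetherianRing
  have hcond : ∀ B : Subalgebra C (FractionRing C), (Subalgebra.toSubmodule B).FG →
      ∃ c : C, c ∈ C⁰ ∧ ∀ b ∈ B, c • b ∈ (⊥ : Subalgebra C (FractionRing C)) := by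
    rintro B ⟨s, hs⟩
    obtain ⟨c, hc⟩ := IsLocalization.exist_integer_multiples_of_finset C⁰ s
    refine ⟨c, c.2, fun b hb => ?_⟩
    have hb' : b ∈ Submodule.span C (s : Set (FractionRing C)) := by rw [hs]; exact hb
    clear hb
    induction hb' using Submodule.span_induction with
    | mem x hx =>
      obtain ⟨r, hr⟩ := hc x hx
      exact Algebra.mem_bot.2 ⟨r, hr⟩
    | zero => simp
    | add x y _ _ hx hy => rw [smul_add]; exact add_mem hx hy
    | smul a x _ hx => rw [smul_comm]; exact Subalgebra.smul_mem _ hx a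
  rw [IsStrictlyClosed, eq_bot_iff]
  intro x hx
  obtain ⟨B, hxB, ⟨s, hs⟩, hxs⟩ := exists_fg_mem_strictClosure hx
  set BK := B.map (integralClosureInQ C).val with hBK
  have hBKfg : (Subalgebra.toSubmodule BK).FG := by
    rw [hBK, ← hs, AlgHom.map_adjoin]
    refine fg_adjoin_of_finite (s.finite_toSet.image _) ?_
    rintro _ ⟨y, -, rfl⟩
    exact y.2
  obtain ⟨c, hc, hcB⟩ := hcond BK hBKfg
  obtain ⟨n, hn⟩ := ENat.ne_top_iff_exists.1 (length_map_mkQ_bot_ne_top (Subalgebra.toSubmodule BK) hc hcB)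
  obtain ⟨B', hb, hBB', -, hs'⟩ := h.isArfIn_bot.exists_isStrictlyClosedIn
    (fun B hB => by
      obtain ⟨c, hc, h⟩ := hcond B hB
      exact ⟨c, IsLocalization.map_units (FractionRing C) ⟨c, hc⟩, h⟩) (n + 1) ⊥ BK bot_le hBKfg
    (by rw [← hn]; exact_mod_cast Nat.lt_succ_self n)
  let _ : Algebra (⊥ : Subalgebra C (FractionRing C)) B' :=
    (Subalgebra.inclusion hb).toRingHom.toAlgebra
  have : IsScalarTower C (⊥ : Subalgebra C (FractionRing C)) B' := .of_algebraMap_eq' rfl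
  let φ : B →ₐ[C] B' :=
    { toFun := fun b => ⟨((b : integralClosureInQ C) : FractionRing C), hBB' ⟨b, b.2, rfl⟩⟩
      map_one' := rfl
      map_mul' := fun _ _ => rfl
      map_zero' := rfl
      map_add' := fun _ _ => rfl
      commutes' := fun _ => rfl }
  have := hs' _ (strictClosure_map (R := (⊥ : Subalgebra C (FractionRing C))) φ hxs)
  obtain ⟨r, hr⟩ := Algebra.mem_bot.1 this
  exact Algebra.mem_bot.2 ⟨r, Subtype.ext hr⟩

/-! ### Relative length of submodules -/

section RelativeLength

variable {C K : Type*} [CommRing C] [AddCommGroup K] [Module C K]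

/-- The length of `P / (N ∩ P)`. -/
def relLength (N P : Submodule C K) : ℕ∞ := Module.length C (P.map N.mkQ)

theorem relLength_add {N₁ N₂ N₃ : Submodule C K} (h₁ : N₁ ≤ N₂) (h₂ : N₂ ≤ N₃) :
    relLength N₁ N₃ = relLength N₁ N₂ + relLength N₂ N₃ := by
  let f : N₂.map N₁.mkQ →ₗ[C] N₃.map N₁.mkQ := Submodule.inclusion (Submodule.map_mono h₂)
  let g : N₃.map N₁.mkQ →ₗ[C] N₃.map N₂.mkQ := (Submodule.factor h₁).restrict (by
    rintro _ ⟨k, hk, rfl⟩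
    exact ⟨k, hk, rfl⟩)
  refine Module.length_eq_add_of_exact f g (Submodule.inclusion_injective _) ?_ ?_
  · rintro ⟨_, k, hk, rfl⟩
    exact ⟨⟨_, k, hk, rfl⟩, rfl⟩
  · rintro ⟨_, k, hk, rfl⟩
    constructor
    · intro h
      have h' : N₂.mkQ k = 0 := congrArg Subtype.val h
      rw [Submodule.mkQ_apply, Submodule.Quotient.mk_eq_zero] at h'
      exact ⟨⟨_, k, h', rfl⟩, rfl⟩
    · rintro ⟨⟨_, k', hk', rfl⟩, h⟩
      have h' : N₁.mkQ k' = N₁.mkQ k := congrArg Subtype.val h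
      apply Subtype.ext
      change N₂.mkQ k = 0
      rw [Submodule.mkQ_apply, Submodule.mkQ_apply, Submodule.Quotient.eq] at h'
      rw [Submodule.mkQ_apply, Submodule.Quotient.mk_eq_zero]
      simpa using sub_mem hk' (h₁ h')

theorem one_le_relLength {N P : Submodule C K} (h : ¬ P ≤ N) : 1 ≤ relLength N P := by
  rw [Order.one_le_iff_pos, relLength, Module.length_pos_iff, Submodule.nontrivial_iff_ne_bot]
  intro h0
  rw [eq_bot_iff, Submodule.map_le_iff_le_comap] at h0
  exact h (by simpa using h0)

theorem relLength_map_equiv (e : K ≃ₗ[C] K) (N P : Submodule C K) :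
    relLength (N.map (e : K →ₗ[C] K)) (P.map (e : K →ₗ[C] K)) = relLength N P := by
  let q := Submodule.Quotient.equiv N (N.map (e : K →ₗ[C] K)) e rfl
  have : (P.map (e : K →ₗ[C] K)).map (N.map (e : K →ₗ[C] K)).mkQ =
      (P.map N.mkQ).map (q : (K ⧸ N) →ₗ[C] (K ⧸ N.map (e : K →ₗ[C] K))) := by
    rw [← Submodule.map_comp, ← Submodule.map_comp]
    rfl
  rw [relLength, relLength, this]
  exact (q.submoduleMap (P.map N.mkQ)).length_eq.symm

end RelativeLength

/-! ### Polynomial equations for a fraction `τ` and a generator of `(1, τ)` -/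

open Polynomial IsLocalRing

theorem coeff_mem_of_mem_smul {R : Type*} [CommRing R] {I : Ideal R} {N : Submodule R R[X]}
    {p : R[X]} (hp : p ∈ I • N) (i : ℕ) : p.coeff i ∈ I := by
  induction hp using Submodule.smul_induction_on' with
  | smul r hr q _ => rw [coeff_smul]; exact I.mul_mem_right _ hr
  | add p _ q _ hp hq => rw [coeff_add]; exact add_mem hp hq

/-- Over a one-dimensional Noetherian local ring, every fraction satisfies a polynomial equation
with at least one unit coefficient. -/
theorem exists_aeval_eq_zero_coeff_notMem {R : Type*} [CommRing R] [IsNoetherianRing R]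
    [IsLocalRing R] [Ring.KrullDimLE 1 R] {c y : R} (hc : c ∈ R⁰) {τ : FractionRing R}
    (hτ : algebraMap R _ c * τ = algebraMap R _ y) :
    ∃ g : R[X], aeval τ g = 0 ∧ ∃ i, g.coeff i ∉ maximalIdeal R := by
  -- Suppose all equations of `τ` have coefficients in the maximal ideal `𝔪`. With `e` the length of
  -- `R / c` and `M` spanned by `1, …, τ ^ e`, these `e + 1` powers are independent modulo `𝔪 M`, so
  -- `M / 𝔪 M` has length at least `e + 1`. But `c ∈ 𝔪`, and `M / c M` has the same length as `R /
  -- c`, namely `e`.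
  by_contra! hcon
  let K := FractionRing R
  have hcm : c ∈ maximalIdeal R := by
    have := hcon (Polynomial.C c * X - Polynomial.C y) (by simp [hτ]) 1
    simpa [coeff_C] using this
  obtain ⟨u, hu⟩ := IsLocalization.map_units K ⟨c, hc⟩
  have hu : (u : K) = algebraMap R K c := hu
  obtain ⟨e, he⟩ := ENat.ne_top_iff_exists.1
    (Module.length_ne_top_iff.2 (isFiniteLength_quotient_span_singleton R hc))
  let f : R[X] →ₗ[R] K := (aeval τ).toLinearMap
  let M : ℕ → Submodule R K := fun n => (degreeLT R n).map f
  have hMmono : Monotone M := fun a b h => Submodule.map_mono (degreeLT_mono h)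
  let E : ℕ → Submodule R K := fun j => maximalIdeal R • M (e + 1) ⊔ M j
  have hEmono : Monotone E := fun a b h => sup_le_sup_left (hMmono h) _
  have hpow : ∀ {i j}, i < j → τ ^ i ∈ M j := fun {i j} h =>
    ⟨X ^ i, mem_degreeLT.2 ((degree_X_pow_le i).trans_lt (by exact_mod_cast h)), by simp [f]⟩
  -- lower bound
  have hlow : ∀ j : ℕ, (j : ℕ∞) ≤ relLength (E 0) (E j) := by
    intro j
    induction j with
    | zero => simp
    | succ j ih =>
      rw [relLength_add (hEmono (Nat.zero_le j)) (hEmono (Nat.le_succ j)), Nat.cast_succ]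
      refine add_le_add ih (one_le_relLength fun hle => ?_)
      have hmem : τ ^ j ∈ E j := hle (Submodule.mem_sup_right (hpow (Nat.lt_succ_self j)))
      obtain ⟨a, ha, b, ⟨q, hq, hb⟩, hab⟩ := Submodule.mem_sup.1 hmem
      rw [← Submodule.map_smul''] at ha
      obtain ⟨p, hp, ha⟩ := ha
      have h1 := hcon (X ^ j - p - q) (by
        have ha : aeval τ p = a := ha
        have hb : aeval τ q = b := hb
        rw [map_sub, map_sub, map_pow, aeval_X, ha, hb, ← hab]; ring) j
      rw [coeff_sub, coeff_sub, coeff_X_pow_self,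
        coeff_eq_zero_of_degree_lt (mem_degreeLT.1 hq), sub_zero] at h1
      exact (maximalIdeal.isMaximal R).ne_top ((Ideal.eq_top_iff_one _).2
        (by simpa using add_mem h1 (coeff_mem_of_mem_smul hp j)))
  -- upper bound
  let N₀ := Subalgebra.toSubmodule (⊥ : Subalgebra R K)
  let μ : K ≃ₗ[R] K := LinearEquiv.ofLinearMap (LinearMap.mulLeft R (u : K))
    (LinearMap.mulLeft R (↑u⁻¹ : K)) (by ext; simp) (by ext; simp)
  have hμ : ∀ k, μ k = c • k := fun k => by rw [Algebra.smul_def, ← hu]; rfl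
  have hN₀M : N₀ ≤ M (e + 1) := by
    intro k hk
    obtain ⟨r, rfl⟩ := Algebra.mem_bot.1 hk
    rw [Algebra.algebraMap_eq_smul_one]
    exact (M _).smul_mem r (by simpa using hpow (Nat.succ_pos e))
  have hμle : ∀ N : Submodule R K, N.map (μ : K →ₗ[R] K) ≤ N := by
    rintro N _ ⟨k, hk, rfl⟩
    change μ k ∈ N
    rw [hμ]; exact N.smul_mem _ hk
  have hfin : relLength N₀ (M (e + 1)) ≠ ⊤ := by
    refine length_map_mkQ_bot_ne_top _ (c := c ^ e) (pow_mem hc e) ?_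
    rintro _ ⟨p, hp, rfl⟩
    change c ^ e • aeval τ p ∈ (⊥ : Subalgebra R K)
    have hdeg : p.natDegree < e + 1 := by
      by_cases hp0 : p = 0
      · simp [hp0]
      · exact (natDegree_lt_iff_degree_lt hp0).2 (mem_degreeLT.1 hp)
    rw [aeval_eq_sum_range' hdeg, Finset.smul_sum]
    refine sum_mem fun i hi => ?_
    have hi : i ≤ e := by simpa [Nat.lt_succ_iff] using hi
    rw [smul_comm]
    refine Subalgebra.smul_mem _ (Algebra.mem_bot.2 ⟨c ^ (e - i) * y ^ i, ?_⟩) _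
    rw [map_mul, map_pow, map_pow, ← hτ, mul_pow, Algebra.smul_def, map_pow, ← mul_assoc,
      ← pow_add, Nat.sub_add_cancel hi]
  -- Compare the chains `c R ⊆ c M ⊆ M` and `c R ⊆ R ⊆ M`, then cancel the finite length of `M / R`,
  -- which equals that of `c M / c R`.
  have hup : relLength ((M (e + 1)).map (μ : K →ₗ[R] K)) (M (e + 1)) =
      relLength (N₀.map (μ : K →ₗ[R] K)) N₀ := by
    have h1 := relLength_add (hμle N₀) hN₀M
    rw [relLength_add (Submodule.map_mono hN₀M) (hμle (M (e + 1))), relLength_map_equiv,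
      add_comm] at h1
    exact (ENat.add_left_injective_of_ne_top hfin) h1
  have hN₀ : relLength (N₀.map (μ : K →ₗ[R] K)) N₀ ≤ e := by
    rw [he]
    let q : (R ⧸ Ideal.span {c}) →ₗ[R] K ⧸ N₀.map (μ : K →ₗ[R] K) :=
      Submodule.liftQ _ ((N₀.map (μ : K →ₗ[R] K)).mkQ ∘ₗ Algebra.linearMap R K) (by
        rw [Ideal.span_le, Set.singleton_subset_iff]
        change (N₀.map (μ : K →ₗ[R] K)).mkQ (algebraMap R K c) = 0
        rw [Submodule.mkQ_apply, Submodule.Quotient.mk_eq_zero]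
        refine ⟨1, one_mem (⊥ : Subalgebra R K), ?_⟩
        change μ 1 = _
        rw [hμ, Algebra.algebraMap_eq_smul_one])
    have hle : N₀.map (N₀.map (μ : K →ₗ[R] K)).mkQ ≤ LinearMap.range q := by
      rintro _ ⟨k, hk, rfl⟩
      obtain ⟨r, rfl⟩ := Algebra.mem_bot.1 hk
      exact ⟨Submodule.Quotient.mk r, rfl⟩
    exact (Module.length_le_of_injective (Submodule.inclusion hle)
      (Submodule.inclusion_injective hle)).trans
      (Module.length_le_of_surjective q.rangeRestrict q.surjective_rangeRestrict)
  have hμE : (M (e + 1)).map (μ : K →ₗ[R] K) ≤ E 0 := by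
    rintro _ ⟨k, hk, rfl⟩
    refine Submodule.mem_sup_left ?_
    change μ k ∈ _
    rw [hμ]
    exact Submodule.smul_mem_smul hcm hk
  have hE : E 0 ≤ E (e + 1) := hEmono (Nat.zero_le _)
  have hEM : E (e + 1) = M (e + 1) := sup_eq_right.2 Submodule.smul_le_right
  have h1 := relLength_add hμE hE
  rw [hEM, hup] at h1
  have h2 := hlow (e + 1)
  rw [hEM] at h2
  have h3 : ((e + 1 : ℕ) : ℕ∞) ≤ e := h2.trans ((h1 ▸ le_add_self).trans hN₀)
  exact absurd (by exact_mod_cast h3) (Nat.not_succ_le_self e)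

open Polynomial IsLocalRing

/-- A polynomial equation with a unit coefficient for `τ` yields a polynomial `h` of degree `e + 1`
in `τ`, with unit leading coefficient and constant term `1`, such that all `τ ^ i / h` with
`i ≤ e + 1` are integral. Here `η = 1 / h`. -/
theorem exists_integral_inverse {R K : Type*} [CommRing R] [IsNoetherianRing R]
    [IsLocalRing R] [CommRing K] [Algebra R K] {τ : K} {G : R[X]} (hG : aeval τ G = 0)
    (hGi : ∃ i, G.coeff i ∉ maximalIdeal R) :
    ∃ (e : ℕ) (g : ℕ → R) (η : K),
      η * (1 + ∑ i ∈ Finset.range (e + 1), g i • τ ^ (i + 1)) = 1 ∧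
      (∀ i ≤ e + 1, IsIntegral R (η * τ ^ i)) ∧
      ∃ (D : ℕ) (c : ℕ → R) (w : ℕ → K), (∀ i, c i ∈ maximalIdeal R) ∧ (∀ i, IsIntegral R (w i)) ∧
        η ^ D * (1 - η) = ∑ i ∈ Finset.range D, c i • w i := by
  classical
  set D := G.natDegree with hD
  have hle : ∀ i, G.coeff i ∉ maximalIdeal R → i ≤ D := fun i hi =>
    le_natDegree_of_ne_zero fun h0 => hi (h0 ▸ zero_mem _)
  set e := Nat.findGreatest (fun i => G.coeff i ∉ maximalIdeal R) D with he
  have heD : e ≤ D := Nat.findGreatest_le D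
  have hge : G.coeff e ∉ maximalIdeal R := by
    obtain ⟨i, hi⟩ := hGi
    exact Nat.findGreatest_spec (P := fun i => G.coeff i ∉ maximalIdeal R) (hle i hi) hi
  have hgt : ∀ i, e < i → G.coeff i ∈ maximalIdeal R := by
    intro i hi
    by_contra h
    exact Nat.findGreatest_is_greatest hi (hle i h) h
  -- `e` is the last index with a unit coefficient. By `τ G(τ) = 0`, `H` is also `1` minus a
  -- combination of higher powers with coefficients in the maximal ideal.
  set H : K := 1 + ∑ i ∈ Finset.range (e + 1), G.coeff i • τ ^ (i + 1) with hH
  have hH' : H = 1 - ∑ i ∈ Finset.Ico (e + 1) (D + 1), G.coeff i • τ ^ (i + 1) := by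
    have h0 : ∑ i ∈ Finset.range (D + 1), G.coeff i • τ ^ (i + 1) = 0 := by
      have h1 : τ * aeval τ G = 0 := by rw [hG, mul_zero]
      rw [aeval_eq_sum_range, Finset.mul_sum] at h1
      rw [← h1]
      refine Finset.sum_congr rfl fun i _ => ?_
      rw [mul_smul_comm, pow_succ']
    rw [← Finset.sum_range_add_sum_Ico _ (Nat.succ_le_succ heD)] at h0
    rw [hH, eq_neg_of_add_eq_zero_left h0]; ring
  let M : ℕ → Submodule R K := fun n => Submodule.span R ((fun i => τ ^ i) '' (Set.Iic n))
  have hM : ∀ {i n}, i ≤ n → τ ^ i ∈ M n := fun {i n} h =>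
    Submodule.subset_span ⟨i, h, rfl⟩
  have hMfg : ∀ n, (M n).FG := fun n => Submodule.fg_span ((Set.finite_Iic n).image _)
  -- Nakayama will give `M N ⊆ H · M D`. Powers up to `τ ^ e` use the second form of `H`, whose
  -- error terms reach exponent at most `N`; powers `τ ^ (e + 1 + l)` with `l ≤ D` use the first
  -- form and the unit `G.coeff e`.
  set N := D + e + 1 with hN
  have hkey : M N ≤ (M D).map (LinearMap.mulLeft R H) := by
    refine Submodule.le_of_le_smul_of_le_jacobson_bot (I := maximalIdeal R) (hMfg N)
      (maximalIdeal_le_jacobson ⊥) (Submodule.span_le.2 ?_)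
    rintro _ ⟨j, hj', rfl⟩
    have hj : j ≤ N := hj'
    clear hj'
    change τ ^ j ∈ _
    induction j using Nat.strong_induction_on with
    | _ j ih =>
      by_cases hje : j ≤ e
      · have h1 : τ ^ j = H * τ ^ j +
            ∑ i ∈ Finset.Ico (e + 1) (D + 1), G.coeff i • τ ^ (i + 1 + j) := by
          rw [hH', sub_mul, Finset.sum_mul]
          simp only [smul_mul_assoc, ← pow_add]
          ring
        rw [h1]
        refine add_mem (Submodule.mem_sup_left ⟨_, hM (hje.trans heD), rfl⟩)
          (sum_mem fun i hi => Submodule.mem_sup_right ?_)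
        rw [Finset.mem_Ico] at hi
        exact Submodule.smul_mem_smul (hgt i hi.1) (hM (by omega))
      · obtain ⟨l, rfl⟩ : ∃ l, j = e + 1 + l := ⟨j - (e + 1), by omega⟩
        have h1 : G.coeff e • τ ^ (e + 1 + l) = H * τ ^ l - τ ^ l -
            ∑ i ∈ Finset.range e, G.coeff i • τ ^ (i + 1 + l) := by
          rw [hH, Finset.sum_range_succ, add_mul, add_mul, Finset.sum_mul]
          simp only [smul_mul_assoc, ← pow_add]
          ring
        obtain ⟨u, hu⟩ : IsUnit (G.coeff e) := by simpa using hge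
        have h2 : G.coeff e • τ ^ (e + 1 + l) ∈
            (M D).map (LinearMap.mulLeft R H) ⊔ maximalIdeal R • M N := by
          rw [h1]
          refine sub_mem (sub_mem (Submodule.mem_sup_left ⟨_, hM (by omega : l ≤ D), rfl⟩)
            (ih l (by omega) (by omega))) (sum_mem fun i hi => Submodule.smul_mem _ _ ?_)
          rw [Finset.mem_range] at hi
          exact ih _ (by omega) (by omega)
        have h3 := Submodule.smul_mem _ (↑u⁻¹ : R) h2
        rwa [smul_smul, ← hu, Units.inv_mul, one_smul] at h3
  obtain ⟨η, -, hη⟩ := hkey (by simpa using hM (Nat.zero_le N) : (1 : K) ∈ M N)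
  have hη : η * H = 1 := by rw [mul_comm]; exact hη
  have hint : ∀ i ≤ e + 1, IsIntegral R (η * τ ^ i) := by
    intro i hi
    refine isIntegral_of_mul_mem (M D) (hMfg D) (by simpa using hM (Nat.zero_le D)) fun y hy => ?_
    have h1 : τ ^ i * y ∈ M N := by
      induction hy using Submodule.span_induction with
      | mem x hx =>
        obtain ⟨j, hj, rfl⟩ := hx
        have hj : j ≤ D := hj
        change τ ^ i * τ ^ j ∈ _
        rw [← pow_add]; exact hM (by omega)
      | zero => simp
      | add x y _ _ hx hy => rw [mul_add]; exact add_mem hx hy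
      | smul a x _ hx => rw [mul_smul_comm]; exact Submodule.smul_mem _ _ hx
    obtain ⟨z, hz, hz'⟩ := hkey h1
    have hz' : H * z = τ ^ i * y := hz'
    rwa [mul_assoc, ← hz', ← mul_assoc, hη, one_mul]
  -- `1 - η` involves `η τ ^ (i + 1)` with `e < i ≤ D`, a range not covered by `hint`. The factor `η
  -- ^ (D + 1)` turns these terms into products of `η τ` and `η`, which are integral.
  refine ⟨e, G.coeff, η, hη, hint, D + 1,
    fun i => if e < i then -G.coeff i else 0,
    fun i => if i ≤ D then η * (η * τ) ^ (i + 1) * η ^ (D - i) else 0, ?_, ?_, ?_⟩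
  · intro i
    dsimp only
    split_ifs with h
    · exact neg_mem (hgt i h)
    · exact zero_mem _
  · have h0 : IsIntegral R η := by simpa using hint 0 (Nat.zero_le _)
    have h1 : IsIntegral R (η * τ) := by simpa using hint 1 (by omega)
    intro i
    dsimp only
    split_ifs
    · exact (h0.mul (h1.pow _)).mul (h0.pow _)
    · exact isIntegral_zero
  · have h1 : 1 - η = -∑ i ∈ Finset.Ico (e + 1) (D + 1), G.coeff i • (η * τ ^ (i + 1)) := by
      have : η * ∑ i ∈ Finset.Ico (e + 1) (D + 1), G.coeff i • τ ^ (i + 1) = η - 1 := by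
        rw [hH', mul_sub, mul_one] at hη
        rw [← hη]; ring
      rw [Finset.mul_sum] at this
      simp only [mul_smul_comm] at this
      rw [this]; ring
    rw [h1, ← Finset.sum_neg_distrib, Finset.mul_sum, Finset.range_eq_Ico,
      ← Finset.sum_subset (Finset.Ico_subset_Ico_left (Nat.zero_le (e + 1)))]
    · refine Finset.sum_congr rfl fun i hi => ?_
      rw [Finset.mem_Ico] at hi
      dsimp only
      rw [if_pos (by omega), if_pos (by omega), mul_neg, neg_smul, mul_smul_comm, mul_pow]
      have : η ^ (D + 1) = η ^ (i + 1) * η ^ (D - i) := by rw [← pow_add]; congr 1; omega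
      rw [this]
      congr 2
      ring
    · intro i hi hi'
      rw [Finset.mem_Ico] at hi hi'
      dsimp only
      rw [if_neg (by omega), zero_smul]

/-- The element `φ = 1 + τ (1 - η)` generates the fractional ideal `(1, τ)` over the integral
closure. -/
theorem exists_eq_mul_of_integral_inverse {R K : Type*} [CommRing R] [IsLocalRing R] [CommRing K]
    [Algebra R K] {τ η : K} {e : ℕ} {g : ℕ → R}
    (hη : η * (1 + ∑ i ∈ Finset.range (e + 1), g i • τ ^ (i + 1)) = 1)
    (hint : ∀ i ≤ e + 1, IsIntegral R (η * τ ^ i)) {D : ℕ} {c : ℕ → R} {w : ℕ → K}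
    (hc : ∀ i, c i ∈ maximalIdeal R) (hw : ∀ i, IsIntegral R (w i))
    (hD : η ^ D * (1 - η) = ∑ i ∈ Finset.range D, c i • w i) :
    ∃ s t : K, IsIntegral R s ∧ IsIntegral R t ∧ 1 = (1 + τ * (1 - η)) * s ∧
      τ = (1 + τ * (1 - η)) * t := by
  set V := integralClosure R K
  let ρ : ℕ → V := fun i => if h : i ≤ e + 1 then ⟨_, hint i h⟩ else 0
  have hρ : ∀ i ≤ e + 1, (ρ i : K) = η * τ ^ i := fun i hi => by simp [ρ, hi]
  have hρ0 : (ρ 0 : K) = η := by simp [hρ 0 (Nat.zero_le _)]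
  let W : ℕ → V := fun i => ⟨w i, hw i⟩
  have hsum : ρ 0 + ∑ i ∈ Finset.range (e + 1), g i • ρ (i + 1) = 1 := by
    apply Subtype.ext
    push_cast
    rw [hρ0, ← hη, mul_add, mul_one, Finset.mul_sum]
    congr 1
    refine Finset.sum_congr rfl fun i hi => ?_
    rw [Finset.mem_range] at hi
    rw [hρ _ (by omega), mul_smul_comm]
  have hDV : ρ 0 ^ D * (1 - ρ 0) = ∑ i ∈ Finset.range D, c i • W i := by
    apply Subtype.ext
    push_cast
    rw [hρ0, hD]
  -- With `φ = 1 + τ (1 - η)`, `𝔞` consists of the `v` such that `v` and `v τ` lie in `φ V`; it is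
  -- enough that no maximal ideal `Q` contains it. If `η ∈ Q`, then `τ` has a pole and `φ` behaves
  -- like `τ`, so `η τ ^ e φ` is tested; otherwise `η ≡ 1` and `φ` behaves like `1`, so `η φ` is
  -- tested.
  let 𝔞 : Ideal V :=
    { carrier := {v | ∃ s t : V, (v : K) = (1 + τ * (1 - η)) * s ∧
        (v : K) * τ = (1 + τ * (1 - η)) * t}
      zero_mem' := ⟨0, 0, by simp, by simp⟩
      add_mem' := by
        rintro v v' ⟨s, t, h, h'⟩ ⟨s', t', k, k'⟩
        refine ⟨s + s', t + t', ?_, ?_⟩ <;> push_cast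
        · rw [h, k]; ring
        · rw [add_mul, h', k']; ring
      smul_mem' := by
        rintro a v ⟨s, t, h, h'⟩
        refine ⟨a * s, a * t, ?_, ?_⟩ <;> rw [smul_eq_mul] <;> push_cast
        · rw [h]; ring
        · rw [mul_assoc, h']; ring }
  have htop : 𝔞 = ⊤ := by
    by_contra hne
    obtain ⟨Q, hQ, hle⟩ := Ideal.exists_le_maximal 𝔞 hne
    have hcomap : Q.comap (algebraMap R V) = maximalIdeal R :=
      IsLocalRing.eq_maximalIdeal (Ideal.isMaximal_comap_of_isIntegral_of_isMaximal Q)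
    by_cases hη0 : ρ 0 ∈ Q
    · have htopρ : ρ (e + 1) ∉ Q := by
        intro h
        have hall : ∀ i ≤ e + 1, ρ i ∈ Q := by
          intro i hi
          refine hQ.isPrime.mem_of_pow_mem (e + 1) ?_
          have : ρ i ^ (e + 1) = ρ 0 ^ (e + 1 - i) * ρ (e + 1) ^ i := by
            apply Subtype.ext
            push_cast
            rw [hρ0, hρ i hi, hρ _ le_rfl, mul_pow, mul_pow, ← mul_assoc, ← pow_add,
              Nat.sub_add_cancel hi, ← pow_mul, ← pow_mul, mul_comm i]
          rw [this]
          rcases Nat.eq_zero_or_pos i with rfl | hi0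
          · exact Ideal.mul_mem_right _ _ (Ideal.pow_mem_of_mem _ hη0 _ (by omega))
          · exact Ideal.mul_mem_left _ _ (Ideal.pow_mem_of_mem _ h _ hi0)
        refine hQ.ne_top ((Ideal.eq_top_iff_one Q).2 ?_)
        rw [← hsum]
        refine add_mem hη0 (sum_mem fun i hi => ?_)
        rw [Finset.mem_range] at hi
        rw [Algebra.smul_def]
        exact Ideal.mul_mem_left _ _ (hall _ (by omega))
      have hρe : ρ e ∈ Q := by
        refine hQ.isPrime.mem_of_pow_mem (e + 1) ?_
        have : ρ e ^ (e + 1) = ρ 0 * ρ (e + 1) ^ e := by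
          apply Subtype.ext
          push_cast
          rw [hρ0, hρ e (by omega), hρ _ le_rfl, mul_pow, mul_pow]
          ring
        rw [this]
        exact Ideal.mul_mem_right _ _ hη0
      have hχ : ρ e + ρ (e + 1) * (1 - ρ 0) ∈ 𝔞 := by
        refine ⟨ρ e, ρ (e + 1), ?_, ?_⟩ <;> push_cast <;>
          rw [hρ0, hρ e (by omega), hρ _ le_rfl] <;> ring
      have h1 := hle hχ
      have h2 : ρ (e + 1) ∈ Q := by
        have : ρ (e + 1) = ρ e + ρ (e + 1) * (1 - ρ 0) - ρ e + ρ (e + 1) * ρ 0 := by ring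
        rw [this]
        exact add_mem (sub_mem h1 hρe) (Ideal.mul_mem_left _ _ hη0)
      exact htopρ h2
    · have h1 : 1 - ρ 0 ∈ Q := by
        have h2 : ρ 0 ^ D * (1 - ρ 0) ∈ Q := by
          rw [hDV]
          refine sum_mem fun i _ => ?_
          rw [Algebra.smul_def]
          refine Ideal.mul_mem_right _ _ ?_
          have := hc i
          rwa [← hcomap] at this
        exact (hQ.isPrime.mem_or_mem h2).resolve_left fun h =>
          hη0 (hQ.isPrime.mem_of_pow_mem D h)
      have hψ : ρ 0 + ρ 1 * (1 - ρ 0) ∈ 𝔞 := by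
        refine ⟨ρ 0, ρ 1, ?_, ?_⟩ <;> push_cast <;>
          rw [hρ0, hρ 1 (by omega)] <;> ring
      exact hη0 (by simpa using sub_mem (hle hψ) (Ideal.mul_mem_left _ (ρ 1) h1))
  obtain ⟨s, t, hs, ht⟩ := (Ideal.eq_top_iff_one 𝔞).1 htop
  exact ⟨s, t, s.2, t.2, by simpa using hs, by simpa using ht⟩

open IsLocalRing

/-! ### Principal reductions from strict closedness -/

section PrincipalReduction

variable {R : Type*} [CommRing R]

/-- Take `f = c φ = c + y - y η`, where `φ = 1 + τ (1 - η)` and `τ = y / c`. The tensor argument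
places `y η` in the strict closure, hence in `R`, and being integral over `I` it lies in `I`. -/
theorem IsStrictlyClosed.exists_common_divisor [IsNoetherianRing R] [IsLocalRing R]
    [Ring.KrullDimLE 1 R] (h : IsStrictlyClosed R) {I : Ideal R}
    (hI : IsIntegrallyClosedIdeal I) {c y : R} (hc : c ∈ I) (hc0 : c ∈ R⁰) (hy : y ∈ I) :
    ∃ f ∈ I, ∃ s t : FractionRing R, IsIntegral R s ∧ IsIntegral R t ∧
      algebraMap R _ c = algebraMap R _ f * s ∧ algebraMap R _ y = algebraMap R _ f * t := by
  set τ := IsLocalization.mk' (FractionRing R) y ⟨c, hc0⟩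
  have hτ : algebraMap R _ c * τ = algebraMap R _ y :=
    IsLocalization.mk'_spec' (FractionRing R) y ⟨c, hc0⟩
  obtain ⟨G, hG, hGi⟩ := exists_aeval_eq_zero_coeff_notMem hc0 hτ
  obtain ⟨e, g, η, hη, hint, D, d, w, hd, hw, hD⟩ := exists_integral_inverse hG hGi
  obtain ⟨s, t, hs, ht, h1, h2⟩ := exists_eq_mul_of_integral_inverse hη hint hd hw hD
  let ρ : ℕ → integralClosureInQ R := fun i => if h : i ≤ e + 1 then ⟨_, hint i h⟩ else 0
  have hρ : ∀ i ≤ e + 1, (ρ i : FractionRing R) = η * τ ^ i := fun i hi => by simp [ρ, hi]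
  have hρ0 : (ρ 0 : FractionRing R) = η := by simp [hρ 0 (Nat.zero_le _)]
  have hmem : y • ρ 0 ∈ strictClosure R (integralClosureInQ R) := by
    refine smul_mem_strictClosure_of_sum_eq_one c y (e + 1) ρ
      -- The coefficients of `1 = η (1 + ∑ g i τ ^ (i + 1))`, hence the shift by one.
      (fun i => if i = 0 then 1 else g (i - 1)) (fun i hi => ?_) ?_
    · apply Subtype.ext
      push_cast
      rw [hρ _ (by omega), hρ _ (by omega), Algebra.smul_def, Algebra.smul_def, ← hτ]
      ring
    · apply Subtype.ext
      rw [Finset.sum_range_succ']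
      push_cast
      simp only [one_smul]
      rw [hρ0, ← hη, add_comm, mul_add, mul_one, Finset.mul_sum]
      congr 1
      refine Finset.sum_congr rfl fun i hi => ?_
      rw [Finset.mem_range] at hi
      rw [hρ _ (by omega), mul_smul_comm]
  rw [h, Algebra.mem_bot] at hmem
  obtain ⟨r, hr⟩ := hmem
  have hr : algebraMap R (FractionRing R) r = algebraMap R _ y * η := by
    have := congrArg (fun t : integralClosureInQ R => (t : FractionRing R)) hr
    simpa [Algebra.smul_def, hρ0] using this
  have hη0 : IsIntegral R η := by simpa using hint 0 (Nat.zero_le _)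
  have hrI : r ∈ I := hI r (isIntegralOverIdeal_of_eq_mul
    (IsFractionRing.injective R (FractionRing R)) hy hη0 hr)
  have hf : algebraMap R (FractionRing R) (c + y - r) =
      algebraMap R _ c * (1 + τ * (1 - η)) := by
    rw [map_sub, map_add, hr, ← hτ]; ring
  refine ⟨c + y - r, sub_mem (add_mem hc hy) hrI, s, t, hs, ht, ?_, ?_⟩
  · rw [hf, mul_assoc, ← h1, mul_one]
  · rw [hf, mul_assoc, ← h2, hτ]

/-- Absorbing generators one at a time gives `f ∈ I` with `I ⊆ f V`. Then `I ^ 2 = f I`: for `y, z ∈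
I` the weak Arf property gives `y z / f ∈ R`, and this is `y` times an integral element, so it lies
in `I`. -/
theorem IsStrictlyClosed.hasPrincipalReduction [IsNoetherianRing R] [IsLocalRing R]
    [Ring.KrullDimLE 1 R] (h : IsStrictlyClosed R) {I : Ideal R} (hI0 : ∃ a ∈ I, a ∈ R⁰)
    (hI : IsIntegrallyClosedIdeal I) : HasPrincipalReduction I := by
  classical
  set K := FractionRing R
  have hinj := IsFractionRing.injective R K
  have key : ∀ s : Finset R, (∀ y ∈ s, y ∈ I) → ∃ f ∈ I, f ∈ R⁰ ∧
      ∀ y ∈ s, ∃ v : K, IsIntegral R v ∧ algebraMap R K y = algebraMap R K f * v := by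
    intro s
    induction s using Finset.induction_on with
    | empty =>
      intro _
      obtain ⟨a, ha, ha0⟩ := hI0
      exact ⟨a, ha, ha0, by simp⟩
    | insert y s _ ih =>
      intro hs
      obtain ⟨c, hc, hc0, hcs⟩ := ih fun z hz => hs z (Finset.mem_insert_of_mem hz)
      obtain ⟨f, hf, v, w, hv, hw, h1, h2⟩ :=
        h.exists_common_divisor hI hc hc0 (hs y (Finset.mem_insert_self _ _))
      refine ⟨f, hf, mem_nonZeroDivisors_of_isUnit_algebraMap
        (isUnit_of_mul_isUnit_left (h1 ▸ IsLocalization.map_units K ⟨c, hc0⟩)), ?_⟩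
      intro z hz
      rcases Finset.mem_insert.1 hz with rfl | hz
      · exact ⟨w, hw, h2⟩
      · obtain ⟨v', hv', h3⟩ := hcs z hz
        exact ⟨v * v', hv.mul hv', by rw [h3, h1, mul_assoc]⟩
  obtain ⟨s, hs⟩ := IsNoetherian.noetherian I
  obtain ⟨f, hf, hf0, hfs⟩ := key s fun y hy => hs ▸ Submodule.subset_span hy
  have hdvd : ∀ y ∈ I, ∃ v : K, IsIntegral R v ∧ algebraMap R K y = algebraMap R K f * v := by
    intro y hy
    rw [← hs] at hy
    induction hy using Submodule.span_induction with
    | mem x hx => exact hfs x hx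
    | zero => exact ⟨0, isIntegral_zero, by simp⟩
    | add x y _ _ hx hy =>
      obtain ⟨v, hv, h1⟩ := hx
      obtain ⟨w, hw, h2⟩ := hy
      exact ⟨v + w, hv.add hw, by rw [map_add, h1, h2, mul_add]⟩
    | smul a x _ hx =>
      obtain ⟨v, hv, h1⟩ := hx
      exact ⟨a • v, hv.smul a, by rw [smul_eq_mul, map_mul, h1, Algebra.smul_def]; ring⟩
  refine ⟨f, hf, 1, le_antisymm ?_ ?_⟩
  · rw [pow_one, pow_succ, pow_one, Ideal.mul_le]
    intro y hy z hz
    obtain ⟨v, hv, h1⟩ := hdvd y hy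
    obtain ⟨w, hw, h2⟩ := hdvd z hz
    have e1 : IsLocalization.mk' K y ⟨f, hf0⟩ = v :=
      IsLocalization.mk'_eq_iff_eq_mul.2 (by rw [h1, mul_comm])
    have e2 : IsLocalization.mk' K z ⟨f, hf0⟩ = w :=
      IsLocalization.mk'_eq_iff_eq_mul.2 (by rw [h2, mul_comm])
    obtain ⟨r, hr⟩ := h.isWeaklyArf ⟨f, hf0⟩ y z (e1 ▸ hv) (e2 ▸ hw)
    have hr' : algebraMap R K (y * z) = algebraMap R K r * algebraMap R K f :=
      IsLocalization.mk'_eq_iff_eq_mul.1 hr.symm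
    refine Ideal.mem_span_singleton_mul.2 ⟨r, hI r ?_, hinj ?_⟩
    · refine isIntegralOverIdeal_of_eq_mul hinj hy hw ?_
      refine (IsLocalization.map_units K ⟨f, hf0⟩).mul_left_cancel ?_
      change algebraMap R K f * _ = algebraMap R K f * _
      rw [mul_comm, ← hr', map_mul, h2]; ring
    · rw [hr', map_mul, mul_comm]
  · rw [pow_one, pow_succ, pow_one]
    exact Ideal.mul_mono_left ((Ideal.span_singleton_le_iff_mem I).2 hf)

end PrincipalReduction

/-! ### Depth zero and depth one -/

section Depth

open RingTheory.Sequence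

/-- A Noetherian local ring has positive depth as soon as its maximal ideal contains a regular
element. -/
theorem one_le_localDepth {R : Type*} [CommRing R] [IsLocalRing R] {r : R}
    (hr : r ∈ maximalIdeal R) (hr0 : r ∈ R⁰) : 1 ≤ localDepth R := by
  have hreg : IsRegular R [r] := by
    refine IsRegular.of_isWeaklyRegular_of_mem_maximalIdeal R (fun x hx => ?_)
      ((isWeaklyRegular_singleton_iff R r).2 (isRegular_iff_mem_nonZeroDivisors.2 hr0).left)
    rwa [List.mem_singleton.1 hx]
  refine le_trans ?_ (le_iSup₂ (f := fun (rs : List R) (_ : rs ∈ {rs : List R |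
    (∀ r ∈ rs, r ∈ maximalIdeal R) ∧ IsRegular R rs}) => (rs.length : ℕ∞)) [r]
    ⟨by simpa using hr, hreg⟩)
  simp

theorem exists_mem_nonZeroDivisors_of_localDepth_ne_zero {R : Type*} [CommRing R] [IsLocalRing R]
    (h : localDepth R ≠ 0) : ∃ r ∈ maximalIdeal R, r ∈ R⁰ := by
  by_contra! hcon
  apply h
  rw [localDepth, ← nonpos_iff_eq_zero]
  refine iSup₂_le fun rs hrs => ?_
  match rs, hrs with
  | [], _ => simp
  | r :: rs, ⟨hm, hreg⟩ =>
    refine absurd ?_ (hcon r (hm r (by simp)))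
    have := ((isRegular_cons_iff R r rs).1 hreg).1
    exact mem_nonZeroDivisors_iff_right.2 fun x hx => this (by simpa [mul_comm] using hx)

theorem localDepth_le_ringKrullDim (R : Type*) [CommRing R] [IsLocalRing R] [IsNoetherianRing R] :
    (localDepth R : WithBot ℕ∞) ≤ ringKrullDim R := by
  obtain ⟨d, hd⟩ := WithBot.ne_bot_iff_exists.1 (ringKrullDim_ne_bot (R := R))
  rw [← hd, WithBot.coe_le_coe, localDepth]
  refine iSup₂_le fun rs hrs => ?_
  have h1 := ringKrullDim_add_length_eq_ringKrullDim_of_isRegular rs hrs.2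
  have : Nontrivial (R ⧸ Ideal.ofList rs) := Ideal.Quotient.nontrivial_iff.2 fun h => by
    have := (Ideal.ofList rs).eq_top_iff_one.1 h
    have hle : Ideal.ofList rs ≤ maximalIdeal R := Ideal.span_le.2 fun r hr => hrs.1 r hr
    exact (maximalIdeal.isMaximal R).ne_top ((Ideal.eq_top_iff_one _).2 (hle this))
  have h2 : (0 : WithBot ℕ∞) ≤ ringKrullDim (R ⧸ Ideal.ofList rs) := ringKrullDim_nonneg_of_nontrivial
  rw [← WithBot.coe_le_coe, hd, ← h1]
  exact le_add_of_nonneg_left h2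

theorem isCohenMacaulayLocal_of_ringKrullDim_eq_one {R : Type*} [CommRing R] [IsLocalRing R]
    [IsNoetherianRing R] (hdim : ringKrullDim R = 1) {r : R} (hr : r ∈ maximalIdeal R)
    (hr0 : r ∈ R⁰) : IsCohenMacaulayLocal R := by
  refine ⟨inferInstance, le_antisymm (localDepth_le_ringKrullDim R) ?_⟩
  rw [hdim]
  exact_mod_cast one_le_localDepth hr hr0

/-- If the maximal ideal is of the form `(b) : c` with `b` regular and `c ∉ (b)`, then the depth
is at most one. -/
theorem localDepth_le_one {R : Type*} [CommRing R] [IsLocalRing R] {b c : R} (hb : b ∈ R⁰)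
    (hc : ¬ b ∣ c) (h : ∀ r ∈ maximalIdeal R, b ∣ r * c) : localDepth R ≤ 1 := by
  rw [localDepth]
  refine iSup₂_le fun rs hrs => ?_
  match rs, hrs with
  | [], _ => simp
  | [r], _ => simp
  | r :: r' :: rs, ⟨hm, hreg⟩ =>
    exfalso
    obtain ⟨h1, h2⟩ := (isRegular_cons_iff R r _).1 hreg
    have h3 := ((isRegular_cons_iff _ r' _).1 h2).1
    obtain ⟨s, hs⟩ := h r (hm r (by simp))
    obtain ⟨s', hs'⟩ := h r' (hm r' (by simp))
    -- From `r c = b s` and `r' c = b s'`. As `r'` is regular modulo `r`, it follows that `r ∣ s`,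
    -- whence `b ∣ c`.
    have e : r' * s = r * s' := by
      refine (isRegular_iff_mem_nonZeroDivisors.2 hb).left ?_
      change b * _ = b * _
      rw [mul_left_comm, ← hs, mul_left_comm b r, ← hs']; ring
    have h0 : r' • (Submodule.Quotient.mk s : QuotSMulTop r R) = 0 := by
      rw [← Submodule.Quotient.mk_smul, Submodule.Quotient.mk_eq_zero, smul_eq_mul, e]
      exact Submodule.smul_mem_pointwise_smul s' r ⊤ trivial
    have h0' : (Submodule.Quotient.mk s : QuotSMulTop r R) = 0 := h3 (by simpa using h0)
    rw [Submodule.Quotient.mk_eq_zero] at h0'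
    obtain ⟨q, -, hq⟩ := h0'
    have hq : r * q = s := hq
    refine hc ⟨q, h1 ?_⟩
    change r * c = r * (b * q)
    rw [hs, ← hq]; ring

end Depth

/-! ### Serre's condition and localization of the total ring of fractions -/

open IsLocalRing

variable {A : Type*} [CommRing A]

/-- If `p` is the annihilator of `z`, then `z` survives in `A_p` and is killed by `p A_p`, so the
depth is zero and Serre's condition forces height zero. -/
theorem mem_minimalPrimes_of_mem_associatedPrimes [IsNoetherianRing A] (hS : SatisfiesSerre A 2)
    {p : Ideal A} (hp : p ∈ associatedPrimes A A) : p ∈ minimalPrimes A := by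
  have := hp.isPrime
  obtain ⟨-, z, hz⟩ := isAssociatedPrime_iff.1 hp
  have hmem : ∀ r, r ∈ p ↔ r * z = 0 := fun r => by
    rw [hz, Submodule.mem_colon_singleton, Submodule.mem_bot, smul_eq_mul]
  have hdepth : localDepth (Localization.AtPrime p) = 0 := by
    by_contra hne
    obtain ⟨r, hr, hr0⟩ := exists_mem_nonZeroDivisors_of_localDepth_ne_zero hne
    obtain ⟨x, s, rfl⟩ := IsLocalization.exists_mk'_eq p.primeCompl r
    rw [IsLocalization.AtPrime.mk'_mem_maximal_iff (Localization.AtPrime p) p] at hr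
    have h0 : algebraMap A (Localization.AtPrime p) z = 0 := by
      refine (mem_nonZeroDivisors_iff_right.1 hr0) _ ?_
      rw [mul_comm, ← IsLocalization.mk'_one (M := p.primeCompl) (Localization.AtPrime p) z,
        ← IsLocalization.mk'_mul, (hmem x).1 hr, IsLocalization.mk'_zero]
    obtain ⟨u, hu⟩ := (IsLocalization.map_eq_zero_iff p.primeCompl _ z).1 h0
    exact u.2 ((hmem u).2 hu)
  have h1 := hS p
  rw [hdepth, min_le_iff] at h1
  rcases h1 with h1 | h1
  · exact absurd h1 (by decide)
  · rw [IsLocalization.AtPrime.ringKrullDim_eq_height p] at h1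
    exact Ideal.height_eq_zero_iff.1 (nonpos_iff_eq_zero.1 (by exact_mod_cast h1))

/-- An element that is regular on `A_P` divides, up to an element outside `P`, a regular element
of `A`. -/
theorem exists_mul_eq_mul_of_map_mem_nonZeroDivisors [IsNoetherianRing A]
    (hS : SatisfiesSerre A 2) (P : Ideal A) [P.IsPrime] {r : A}
    (hr : algebraMap A (Localization.AtPrime P) r ∈ (Localization.AtPrime P)⁰) :
    ∃ t, ∃ u ∈ P.primeCompl, ∃ b ∈ A⁰, r * t = u * b := by
  by_contra! hcon
  -- Otherwise a prime `q ⊆ P` contains `r` and only zero divisors, so it is minimal and `u r ^ n =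
  -- 0` for some `u ∉ q`. Regularity of `r` on `A_P` then kills `u` in `A_P`, which is impossible.
  have hdisj : Disjoint (Ideal.span {r} : Set A) (P.primeCompl ⊔ A⁰ : Submonoid A) := by
    rw [Set.disjoint_left]
    intro x hx hx'
    obtain ⟨t, rfl⟩ := Ideal.mem_span_singleton.1 hx
    obtain ⟨u, hu, b, hb, h⟩ := Submonoid.mem_sup.1 hx'
    exact hcon t u hu b hb h.symm
  obtain ⟨q, hq, hrq, hqd⟩ := Ideal.exists_le_prime_disjoint _ _ hdisj
  have hrq : r ∈ q := hrq (Ideal.mem_span_singleton_self r)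
  have hqP : q ≤ P := fun x hx => by
    by_contra h
    exact Set.disjoint_left.1 hqd hx (Submonoid.mem_sup_left h)
  have hsub : (q : Set A) ⊆ ⋃ p ∈ associatedPrimes A A, (id p : Ideal A) := by
    simp only [id]
    rw [biUnion_associatedPrimes_eq_compl_nonZeroDivisors]
    exact fun x hx h => Set.disjoint_left.1 hqd hx (Submonoid.mem_sup_right h)
  obtain ⟨p, hp, hqp⟩ := (Ideal.subset_union_prime_finite (associatedPrimes.finite A A) ⊥ ⊥
    (fun p hp _ _ => hp.isPrime)).1 hsub
  have hpmin := mem_minimalPrimes_of_mem_associatedPrimes hS hp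
  have hqmin : q ∈ minimalPrimes A := by
    have : q = p := le_antisymm hqp (hpmin.2 ⟨hq, bot_le⟩ hqp)
    exact this ▸ hpmin
  obtain ⟨u, hu, n, hun⟩ : ∃ u ∉ q, ∃ n, u * r ^ n = 0 := by
    have hnil : algebraMap A (Localization.AtPrime q) r ∈ nilradical (Localization.AtPrime q) := by
      rw [nilradical_eq_sInf, Ideal.mem_sInf]
      intro J hJ
      have : J.IsPrime := hJ
      have hJq : J.comap (algebraMap A (Localization.AtPrime q)) ≤ q :=
        (IsLocalization.AtPrime.orderIsoOfPrime (Localization.AtPrime q) q ⟨J, hJ⟩).2.2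
      have := hqmin.2 ⟨Ideal.comap_isPrime _ J, bot_le⟩ hJq
      exact this hrq
    obtain ⟨n, hn⟩ := hnil
    rw [← map_pow] at hn
    obtain ⟨u, hu⟩ := (IsLocalization.map_eq_zero_iff q.primeCompl _ _).1 hn
    exact ⟨u, u.2, n, hu⟩
  have h0 : algebraMap A (Localization.AtPrime P) u = 0 := by
    refine (mem_nonZeroDivisors_iff_right.1 (pow_mem hr n)) _ ?_
    rw [← map_pow, ← map_mul, hun, map_zero]
  obtain ⟨s, hs⟩ := (IsLocalization.map_eq_zero_iff P.primeCompl _ _).1 h0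
  have hsq : (s : A) * u ∈ q := hs ▸ q.zero_mem
  exact (hq.mem_or_mem hsq).elim (fun h => s.2 (hqP h)) hu

section FractionMap

variable (P : Ideal A) [P.IsPrime]

/-- The map `Q(A) → Q(A_P)`. -/
def fractionMap : FractionRing A →ₐ[A] FractionRing (Localization.AtPrime P) :=
  IsLocalization.liftAlgHom (M := A⁰)
    (f := Algebra.ofId A (FractionRing (Localization.AtPrime P))) fun b => by
      have hb := IsLocalization.map_nonZeroDivisors_le P.primeCompl (Localization.AtPrime P)
        (Submonoid.mem_map_of_mem _ b.2)
      rw [Algebra.ofId_apply, IsScalarTower.algebraMap_apply A (Localization.AtPrime P)]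
      exact IsLocalization.map_units _ (⟨_, hb⟩ : (Localization.AtPrime P)⁰)

theorem exists_smul_eq_zero_of_fractionMap_eq_zero {k : FractionRing A}
    (hk : fractionMap P k = 0) : ∃ u ∈ P.primeCompl, u • k = 0 := by
  obtain ⟨a, b, rfl⟩ := IsLocalization.exists_mk'_eq A⁰ k
  have h1 : fractionMap P (algebraMap A _ a) = 0 := by
    rw [← IsLocalization.mk'_spec (FractionRing A) a b, map_mul, hk, zero_mul]
  rw [AlgHom.commutes, IsScalarTower.algebraMap_apply A (Localization.AtPrime P)] at h1
  have h2 := (map_eq_zero_iff _ (IsFractionRing.injective (Localization.AtPrime P) _)).1 h1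
  obtain ⟨u, hu⟩ := (IsLocalization.map_eq_zero_iff P.primeCompl _ _).1 h2
  refine ⟨u, u.2, ?_⟩
  rw [IsLocalization.smul_mk', hu, IsLocalization.mk'_zero]

/-- A denominator regular on `A_P` can be replaced, up to elements outside `P`, by one regular on
`A`. This is the surjectivity half of `Q(A)_P = Q(A_P)`. -/
theorem exists_smul_eq_fractionMap [IsNoetherianRing A] (hS : SatisfiesSerre A 2)
    (z : FractionRing (Localization.AtPrime P)) :
    ∃ u ∈ P.primeCompl, ∃ k, u • z = fractionMap P k := by
  let R := Localization.AtPrime P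
  let L := FractionRing R
  obtain ⟨α, β, hz⟩ := IsLocalization.exists_mk'_eq R⁰ z
  obtain ⟨a, s, hα⟩ := IsLocalization.exists_mk'_eq P.primeCompl α
  obtain ⟨r, s', hβ⟩ := IsLocalization.exists_mk'_eq P.primeCompl (β : R)
  have hα' : α * algebraMap A R s = algebraMap A R a := by rw [← hα, IsLocalization.mk'_spec]
  have hβ' : (β : R) * algebraMap A R s' = algebraMap A R r := by
    rw [← hβ, IsLocalization.mk'_spec]
  have hr : algebraMap A R r ∈ R⁰ := by
    rw [← hβ']
    exact mul_mem β.2 (IsLocalization.map_units R s').mem_nonZeroDivisors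
  obtain ⟨t, u, hu, b, hb, h⟩ := exists_mul_eq_mul_of_map_mem_nonZeroDivisors hS P hr
  refine ⟨s * u, mul_mem s.2 hu,
    IsLocalization.mk' (FractionRing A) (a * t * s') (⟨b, hb⟩ : A⁰), ?_⟩
  have hbu : IsUnit (algebraMap A L b) := by
    have := (IsLocalization.map_units (FractionRing A) (⟨b, hb⟩ : A⁰)).map (fractionMap P)
    rwa [AlgHom.commutes] at this
  have hβu : IsUnit (algebraMap R L β) := IsLocalization.map_units L β
  refine (hβu.mul hbu).mul_left_cancel ?_
  have e1 : algebraMap A L b * fractionMap P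
      (IsLocalization.mk' (FractionRing A) (a * t * s') (⟨b, hb⟩ : A⁰)) =
      algebraMap A L (a * t * s') := by
    have e0 : algebraMap A (FractionRing A) b * IsLocalization.mk' (FractionRing A) (a * t * s')
        (⟨b, hb⟩ : A⁰) = algebraMap A _ (a * t * s') := 
      IsLocalization.mk'_spec' (M := A⁰) (FractionRing A) (a * t * s') ⟨b, hb⟩
    rw [← AlgHom.commutes (fractionMap P), ← map_mul, e0, AlgHom.commutes]
  rw [mul_assoc, mul_assoc, e1, Algebra.smul_def]
  have e2 : algebraMap R L β * z = algebraMap R L α := by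
    rw [← hz]; exact IsLocalization.mk'_spec' L α β
  have e3 : algebraMap R L α * algebraMap A L s = algebraMap A L a := by
    rw [IsScalarTower.algebraMap_apply A R L, IsScalarTower.algebraMap_apply A R L, ← hα', map_mul]
  have e4 : algebraMap R L β * algebraMap A L s' = algebraMap A L r := by
    rw [IsScalarTower.algebraMap_apply A R L, IsScalarTower.algebraMap_apply A R L, ← hβ', map_mul]
  have e5 : algebraMap A L r * algebraMap A L t = algebraMap A L u * algebraMap A L b := by
    rw [← map_mul, h, map_mul]
  rw [map_mul, map_mul, map_mul]
  calc algebraMap R L β * (algebraMap A L b * (algebraMap A L s * algebraMap A L u * z))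
      = (algebraMap R L β * z) * algebraMap A L s *
          (algebraMap A L u * algebraMap A L b) := by ring
    _ = algebraMap A L a * (algebraMap R L β * algebraMap A L s' * algebraMap A L t) := by
        rw [e2, e3, ← e5, e4]
    _ = _ := by ring

/-- The map from the integral closure of `A` to that of `A_P`. -/
def integralClosureMap : integralClosureInQ A →ₐ[A] integralClosureInQ (Localization.AtPrime P) :=
  AlgHom.codRestrict ((fractionMap P).comp (integralClosureInQ A).val)
    ((integralClosureInQ (Localization.AtPrime P)).restrictScalars A) fun x =>
      ((x.2 : IsIntegral A (x : FractionRing A)).map (fractionMap P)).tower_top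

/-- Once `Q(A_P)` is the localization of `Q(A)` at the complement of `P`, integral closure commutes
with this localization. -/
theorem isLocalizedModule_integralClosureMap [IsNoetherianRing A] (hS : SatisfiesSerre A 2) :
    IsLocalizedModule P.primeCompl (integralClosureMap P).toLinearMap := by
  let _ : Algebra (FractionRing A) (FractionRing (Localization.AtPrime P)) :=
    (fractionMap P).toRingHom.toAlgebra
  have : IsScalarTower A (FractionRing A) (FractionRing (Localization.AtPrime P)) :=
    .of_algebraMap_eq' (fractionMap P).comp_algebraMap.symm
  let _ : Algebra (integralClosureInQ A) (integralClosureInQ (Localization.AtPrime P)) :=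
    (integralClosureMap P).toRingHom.toAlgebra
  have : IsScalarTower (integralClosureInQ A) (integralClosureInQ (Localization.AtPrime P))
    (FractionRing (Localization.AtPrime P)) := .of_algebraMap_eq' rfl
  have : IsScalarTower A (integralClosureInQ A) (integralClosureInQ (Localization.AtPrime P)) :=
    .of_algebraMap_eq' (integralClosureMap P).comp_algebraMap.symm
  have : IsLocalization (Algebra.algebraMapSubmonoid (FractionRing A) P.primeCompl)
      (FractionRing (Localization.AtPrime P)) := by
    refine ⟨⟨?_, ?_, ?_⟩⟩
    · rintro ⟨_, s, hs, rfl⟩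
      change IsUnit (fractionMap P (algebraMap A _ s))
      rw [AlgHom.commutes, IsScalarTower.algebraMap_apply A (Localization.AtPrime P)]
      exact (IsLocalization.map_units (Localization.AtPrime P)
        (⟨s, hs⟩ : P.primeCompl)).map (algebraMap _ _)
    · intro z
      obtain ⟨u, hu, k, h⟩ := exists_smul_eq_fractionMap P hS z
      refine ⟨⟨k, _, u, hu, rfl⟩, ?_⟩
      change z * fractionMap P (algebraMap A _ u) = fractionMap P k
      rw [AlgHom.commutes, ← h, Algebra.smul_def, mul_comm]
    · intro x y hxy
      have hxy : fractionMap P x = fractionMap P y := hxy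
      obtain ⟨u, hu, h⟩ := exists_smul_eq_zero_of_fractionMap_eq_zero P (k := x - y)
        (by rw [map_sub, hxy, sub_self])
      refine ⟨⟨_, u, hu, rfl⟩, ?_⟩
      rw [smul_sub, sub_eq_zero, Algebra.smul_def, Algebra.smul_def] at h
      exact h
  have := IsLocalization.integralClosure (R := A) (S := FractionRing A)
    (Rf := Localization.AtPrime P) (Sf := FractionRing (Localization.AtPrime P)) P.primeCompl
  exact isLocalizedModule_iff_isLocalization.2 this

/-- Strict closedness localizes. -/
theorem IsStrictlyClosed.localization [IsNoetherianRing A] (hS : SatisfiesSerre A 2)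
    (h : IsStrictlyClosed A) : IsStrictlyClosed (Localization.AtPrime P) := by
  have hloc := isLocalizedModule_integralClosureMap P hS
  rw [IsStrictlyClosed, eq_bot_iff]
  intro x hx
  obtain ⟨⟨v, s⟩, hs⟩ := IsLocalizedModule.surj P.primeCompl (integralClosureMap P).toLinearMap x
  have hs : (s : A) • x = integralClosureMap P v := hs
  have hv : integralClosureMap P v ∈ strictClosure (Localization.AtPrime P)
      (integralClosureInQ (Localization.AtPrime P)) := by
    rw [← hs, ← algebraMap_smul (Localization.AtPrime P)]
    exact Subalgebra.smul_mem _ hx _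
  obtain ⟨s', hs', hv'⟩ := exists_smul_mem_strictClosure P.primeCompl (integralClosureMap P) hv
  rw [h, Algebra.mem_bot] at hv'
  obtain ⟨a, ha⟩ := hv'
  have h1 : algebraMap (Localization.AtPrime P) (integralClosureInQ (Localization.AtPrime P))
      (algebraMap A _ (s' * s)) * x = algebraMap (Localization.AtPrime P) _ (algebraMap A _ a) := by
    rw [← IsScalarTower.algebraMap_apply, ← IsScalarTower.algebraMap_apply,
      ← AlgHom.commutes (integralClosureMap P) a, ha, map_smul, ← hs, ← Algebra.smul_def, mul_smul]
  obtain ⟨w, hw⟩ := IsLocalization.map_units (Localization.AtPrime P)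
    (⟨s' * s, mul_mem hs' s.2⟩ : P.primeCompl)
  have hw : (w : Localization.AtPrime P) = algebraMap A _ (s' * s) := hw
  refine Algebra.mem_bot.2 ⟨↑w⁻¹ * algebraMap A _ a, ?_⟩
  rw [map_mul, ← h1, ← mul_assoc, ← map_mul, ← hw, Units.inv_mul, map_one, one_mul]

end FractionMap

/-! ### Reduction to primes of height one -/

open IsLocalRing

variable {A : Type*} [CommRing A]

theorem ringKrullDim_localization_eq_one {P : Ideal A} [P.IsPrime] (hP : P.height = 1) :
    ringKrullDim (Localization.AtPrime P) = 1 := by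
  rw [IsLocalization.AtPrime.ringKrullDim_eq_height P, hP]; rfl

theorem krullDimLE_one_localization {P : Ideal A} [P.IsPrime] (hP : P.height = 1) :
    Ring.KrullDimLE 1 (Localization.AtPrime P) := by
  rw [Ring.KrullDimLE, Order.krullDimLE_iff]
  exact (ringKrullDim_localization_eq_one hP).le

/-- A one-dimensional Noetherian local ring of positive depth that is strictly closed is Arf. -/
theorem IsStrictlyClosed.isArf {R : Type*} [CommRing R] [IsNoetherianRing R] [IsLocalRing R]
    (h : IsStrictlyClosed R) (hdim : ringKrullDim R = 1) (hdepth : localDepth R ≠ 0) :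
    IsArf R where
  isNoetherianRing := inferInstance
  semilocal := by
    have : Subsingleton (MaximalSpectrum R) := ⟨fun x y => MaximalSpectrum.ext
      ((eq_maximalIdeal x.isMaximal).trans (eq_maximalIdeal y.isMaximal).symm)⟩
    infer_instance
  cohenMacaulay := by
    intro M hM
    obtain rfl := eq_maximalIdeal hM
    obtain ⟨r, hr, hr0⟩ := exists_mem_nonZeroDivisors_of_localDepth_ne_zero hdepth
    have hd : ringKrullDim (Localization.AtPrime (maximalIdeal R)) = 1 := by
      rw [IsLocalization.AtPrime.ringKrullDim_eq_height (maximalIdeal R),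
        maximalIdeal_height_eq_ringKrullDim, hdim]
    refine ⟨isCohenMacaulayLocal_of_ringKrullDim_eq_one hd
      (r := algebraMap R (Localization.AtPrime (maximalIdeal R)) r) ?_ ?_, hd⟩
    · rwa [IsLocalization.AtPrime.to_map_mem_maximal_iff _ (maximalIdeal R)]
    · exact IsLocalization.map_nonZeroDivisors_le (maximalIdeal R).primeCompl _
        (Submonoid.mem_map_of_mem _ hr0)
  principalReduction := by
    intro I hI0 hI
    have : Ring.KrullDimLE 1 R := by
      rw [Ring.KrullDimLE, Order.krullDimLE_iff]; exact hdim.le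
    exact h.hasPrincipalReduction hI0 hI
  weaklyArf := h.isWeaklyArf

/-- Under `(S₂)`, an associated prime of `Q(A) / A` has height one. -/
theorem height_eq_one_of_mem_associatedPrimes [IsNoetherianRing A] (hS : SatisfiesSerre A 2)
    {P : Ideal A} [P.IsPrime] {y : FractionRing A}
    (hP : ∀ r, r ∈ P ↔ r • y ∈ LinearMap.range (Algebra.linearMap A (FractionRing A))) :
    P.height = 1 := by
  obtain ⟨c, b, rfl⟩ := IsLocalization.exists_mk'_eq A⁰ y
  have hP' : ∀ r, r ∈ P ↔ (b : A) ∣ r * c := by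
    intro r
    rw [hP]
    constructor
    · rintro ⟨t, ht⟩
      refine ⟨t, IsFractionRing.injective A (FractionRing A) ?_⟩
      rw [Algebra.linearMap_apply, IsLocalization.smul_mk',
        IsLocalization.eq_mk'_iff_mul_eq] at ht
      rw [← ht, map_mul, mul_comm]
    · rintro ⟨t, ht⟩
      refine ⟨t, ?_⟩
      rw [Algebra.linearMap_apply, IsLocalization.smul_mk', IsLocalization.eq_mk'_iff_mul_eq, ht,
        map_mul, mul_comm]
  have hbP : (b : A) ∈ P := (hP' b).2 (dvd_mul_right _ _)
  -- The description `P = (b) : c` survives localization, and `b` still does not divide `c` in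
  -- `A_P`.
  have hdepth : localDepth (Localization.AtPrime P) ≤ 1 := by
    refine localDepth_le_one (b := algebraMap A _ (b : A)) (c := algebraMap A _ c)
      (IsLocalization.map_nonZeroDivisors_le P.primeCompl _
        (Submonoid.mem_map_of_mem _ b.2)) ?_ ?_
    · rintro ⟨q, hq⟩
      obtain ⟨q, s, rfl⟩ := IsLocalization.exists_mk'_eq P.primeCompl q
      have h1 : algebraMap A (Localization.AtPrime P) (s * c) = algebraMap A _ (b * q) := by
        rw [map_mul, hq, mul_left_comm, IsLocalization.mk'_spec', map_mul]
      obtain ⟨u, hu⟩ := (IsLocalization.eq_iff_exists P.primeCompl _).1 h1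
      have h2 : (u * s : A) ∈ P := (hP' _).2 ⟨u * q, by rw [mul_assoc, hu]; ring⟩
      exact (‹P.IsPrime›.mem_or_mem h2).elim u.2 s.2
    · intro r hr
      obtain ⟨p, s, rfl⟩ := IsLocalization.exists_mk'_eq P.primeCompl r
      have hp : p ∈ P := (IsLocalization.AtPrime.mk'_mem_maximal_iff
        (Localization.AtPrime P) P p s).1 hr
      obtain ⟨t, ht⟩ := (hP' p).1 hp
      refine ⟨IsLocalization.mk' (Localization.AtPrime P) t s, ?_⟩
      refine (IsLocalization.map_units (Localization.AtPrime P) s).mul_left_cancel ?_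
      rw [← mul_assoc, IsLocalization.mk'_spec', mul_left_comm, IsLocalization.mk'_spec',
        ← map_mul, ← map_mul, ht]
  have hle : P.height ≤ 1 := by
    have h1 := (hS P).trans (WithBot.coe_le_coe.2 hdepth)
    rw [IsLocalization.AtPrime.ringKrullDim_eq_height P, min_le_iff] at h1
    rcases h1 with h1 | h1
    · exact absurd h1 (by decide)
    · exact_mod_cast h1
  refine le_antisymm hle (Order.one_le_iff_ne_zero.2 fun h0 => ?_)
  have hmin : P ∈ minimalPrimes A := Ideal.height_eq_zero_iff.1 h0
  exact Set.disjoint_left.1 (Ideal.disjoint_nonZeroDivisors_of_mem_minimalPrimes hmin) hbP b.2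

/-- An `x` outside `A` has a nonzero class in `Q(A) / A`, whose annihilator lies in an associated
prime `P`, of height one by `(S₂)`. Strict closedness of `A_P` gives an element outside `P`
multiplying `x` into `A`, a contradiction. -/
theorem isStrictlyClosed_of_localization [IsNoetherianRing A] (hS : SatisfiesSerre A 2)
    (h : ∀ (P : Ideal A) [P.IsPrime], P.height = 1 →
      IsStrictlyClosed (Localization.AtPrime P)) : IsStrictlyClosed A := by
  rw [IsStrictlyClosed, eq_bot_iff]
  intro x hx
  by_contra hxA
  set N := LinearMap.range (Algebra.linearMap A (FractionRing A))
  have hx0 : N.mkQ (x : FractionRing A) ≠ 0 := by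
    rw [Submodule.mkQ_apply, Ne, Submodule.Quotient.mk_eq_zero]
    rintro ⟨r, hr⟩
    exact hxA (Algebra.mem_bot.2 ⟨r, Subtype.ext hr⟩)
  obtain ⟨P, hP, hle⟩ := exists_le_isAssociatedPrime_of_isNoetherianRing A _ hx0
  obtain ⟨hPp, y, hy⟩ := isAssociatedPrime_iff.1 hP
  obtain ⟨y, rfl⟩ := N.mkQ_surjective y
  have hmem : ∀ (r : A) (k : FractionRing A),
      r ∈ (⊥ : Submodule A (FractionRing A ⧸ N)).colon {N.mkQ k} ↔ r • k ∈ N := fun r k => by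
    rw [Submodule.mem_colon_singleton, Submodule.mem_bot, ← map_smul, Submodule.mkQ_apply,
      Submodule.Quotient.mk_eq_zero]
  have hht := height_eq_one_of_mem_associatedPrimes hS (P := P) fun r => by rw [hy, hmem]
  have hx' := strictClosure_map (R := Localization.AtPrime P) (integralClosureMap P) hx
  rw [h P hht, Algebra.mem_bot] at hx'
  obtain ⟨z, hz⟩ := hx'
  obtain ⟨a, s, rfl⟩ := IsLocalization.exists_mk'_eq P.primeCompl z
  have hz' : algebraMap (Localization.AtPrime P) (FractionRing (Localization.AtPrime P))
      (IsLocalization.mk' _ a s) = fractionMap P x :=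
    congrArg (fun t : integralClosureInQ (Localization.AtPrime P) =>
      (t : FractionRing (Localization.AtPrime P))) hz
  obtain ⟨u, hu, h0⟩ := exists_smul_eq_zero_of_fractionMap_eq_zero P
    (k := (s : A) • (x : FractionRing A) - algebraMap A _ a) (by
      rw [map_sub, map_smul, ← hz', AlgHom.commutes, sub_eq_zero,
        IsScalarTower.algebraMap_apply A (Localization.AtPrime P)
          (FractionRing (Localization.AtPrime P)) a,
        ← IsLocalization.mk'_spec' (Localization.AtPrime P) a s, map_mul, Algebra.smul_def,
        ← IsScalarTower.algebraMap_apply])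
  have hmemP : u * s ∈ P := hle ((hmem _ _).2 ⟨u * a, by
    rw [smul_sub, sub_eq_zero] at h0
    rw [mul_smul, h0, Algebra.linearMap_apply, map_mul, Algebra.smul_def]⟩)
  exact (hPp.mem_or_mem hmemP).elim hu s.2

end StrictClosedness

end

theorem theorem4p4 (A : Type*) [CommRing A] [IsNoetherianRing A]
    (hS2 : StrictClosedness.SatisfiesSerre A 2) :
    StrictClosedness.IsStrictlyClosed A ↔
      StrictClosedness.IsWeaklyArf A ∧
        ∀ (P : Ideal A) [P.IsPrime], P.height = 1 →
          StrictClosedness.IsArf (Localization.AtPrime P) := by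
  refine ⟨fun h => ⟨h.isWeaklyArf, fun P _ hP => ?_⟩, fun h => ?_⟩
  · have hdim := StrictClosedness.ringKrullDim_localization_eq_one hP
    refine (h.localization P hS2).isArf hdim fun h0 => ?_
    have h1 := hS2 P
    rw [h0, hdim] at h1
    exact absurd h1 (by decide)
  · refine StrictClosedness.isStrictlyClosed_of_localization hS2 fun P _ hP => ?_
    have := StrictClosedness.krullDimLE_one_localization hP
    exact (h.2 P hP).isStrictlyClosed
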